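/- Let $E$ be a Dedekind complete $\Phi$-algebra, i.e. a real lattice-ordered algebra with unit in which every nonempty order bounded above set has a supremum, products of positive elements are positive, and $x\wedge y=0$, $z\ge 0$ imply $(zx)\wedge y=(xz)\wedge y=0$. Write $x\ll y$ if $y-x$ is a weak order unit of $E$ (it is positive, and only $0$ is disjoint from it), $[a,b]=\{x: a\le x\le b\}$ and $(a,b)=\{x: a\ll x\ll b\}$. $\Delta\downarrow 0$ means that $\Delta\subseteq E$ is nonempty and downwards directed with infimum $0$; $\mathcal E\searrow 0$ means that $\mathcal E\subseteq E$ has infimum $0$. A net $x_\alpha$ converges (in order) to $x$ if there is $\mathcal E\searrow 0$ such that for every $\varepsilon\in\mathcal E$ eventually $|x_\alpha-x|\le\varepsilon$. A function $f\colon \mathrm{dom}(f)\to E$ with $\mathrm{dom}(f)\subseteq E$ is *order continuous* if $x_\alpha\to x$ in $\mathrm{dom}(f)$ implies $f(x_\alpha)\to f(x)$; *uniformly order continuous* if $x_\alpha-y_\alpha\to 0$ in $\mathrm{dom}(f)$ implies $f(x_\alpha)-f(y_\alpha)\to 0$; *locally band preserving* if $\mathbb P x=\mathbb P y$ implies $\mathbb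 P f(x)=\mathbb P f(y)$ for every band projection $\mathbb P$ and all $x,y\in\mathrm{dom}(f)$; *order differentiable at $p$ with derivative $f'(p)$* if there is $r\gg 0$ with $(p-r,p+r)\subseteq\mathrm{dom}(f)$ such that for every $\Delta\downarrow 0$ there is $\mathcal E\searrow 0$ such that for every $\varepsilon\in\mathcal E$ there is $\delta\in\Delta$ with \[ x\in(p-r,p+r),\ |x-p|\le\delta \implies |f(x)-f(p)-(x-p)f'(p)|\le|x-p|\,\varepsilon ; \] and *super order differentiable at $p$* if the same holds with this implication required for all $x\in\mathrm{dom}(f)$ instead of all $x\in(p-r,p+r)$. For $a\le b$, a function $f$ that is order bounded on $[a,b]$ is *(Darboux) integrable on $[a,b]$* if the supremum of its lower sums $\sum_i \inf f([x_{i-1},x_i])\,(x_i-x_{i-1})$ and the infimum of its upper sums $\sum_i \sup f([x_{i-1},x_i])\,(x_i-x_{i-1})$ over all partitions $a=x_0\le x_1\le\dots\le x_n=b$ coincide; the common value is its integral. For arbitrary $a,b\in E$, $f$ is *integrable from $a$ to $b$* if it is integrable on $[a\wedge b,a\vee b]$, and then \[ \int_a^b f(x)\,dx:=\mathbb P_{a<b}\Big(\int_{a\wedge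 b}^{a\vee b} f(x)\,dx\Big)-\mathbb P_{b<a}\Big(\int_{a\wedge b}^{a\vee b} f(x)\,dx\Big), \] where $\mathbb P_{a<b}$ is the band projection onto the largest band $B$ for which the component of $b-a$ in $B$ is a weak order unit of $B$. **Proposition.** Let $a\ll b$ and $c\ll d$ in $E$, and let $g\colon[a,b]\to E$ and $f\colon[c,d]\to E$ be locally band preserving, and $G\colon[a,b]\to[c,d]$. (i) Suppose that $f$ and $g$ are order continuous and integrable, that $G$ is locally band preserving, order continuous on $[a,b]$, and order differentiable at every point of $(a,b)$ with $G'=g$ there. If $(f\circ G)g$ is integrable on $[a,b]$, then $f$ is integrable from $G(a)$ to $G(b)$ and \[ \int_a^b f(G(x))\,g(x)\,dx=\int_{G(a)}^{G(b)} f(u)\,du. \] (ii) Suppose that $f$ and $g$ are uniformly order continuous, and that $G$ is uniformly order continuous and super order differentiable at every point of $(a,b)$ with $G'=g$ there. Then $(f\circ G)g$ is integrable on $[a,b]$, $f$ is integrable from $G(a)$ to $G(b)$, and the same formula holds. -/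

import Mathlib

open Set

universe u

namespace RieszIntegral

section Algebra

/-- The `f`-algebra axioms for a lattice-ordered ring: products of positive elements are positive,
and multiplication by a positive element, on either side, preserves disjointness.
Commutativity is not assumed. A `Φ`-algebra is a unital `f`-algebra. -/
class IsFAlgebra (E : Type u) [Ring E] [Lattice E] : Prop where
  mul_nonneg : ∀ x y : E, 0 ≤ x → 0 ≤ y → 0 ≤ x * y
  mul_inf_eq_zero : ∀ x y z : E, x ⊓ y = 0 → 0 ≤ z → (z * x) ⊓ y = 0 ∧ (x * z) ⊓ y = 0

end Algebra

section Bands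

variable {E : Type u} [Ring E] [ConditionallyCompleteLattice E] [Algebra ℝ E]

/-- A band: a solid linear subspace that contains every supremum (in `E`) of its subsets. -/
def IsBand (B : Submodule ℝ E) : Prop :=
  (∀ x ∈ B, ∀ y : E, |y| ≤ |x| → y ∈ B) ∧
    ∀ S : Set E, S ⊆ (B : Set E) → ∀ x : E, IsLUB S x → x ∈ B

/-- The band projection onto the band `B` of a Dedekind complete vector lattice:
`ℙ x = sup {y ∈ B : 0 ≤ y ≤ x}` for `x ≥ 0`, and `ℙ x = ℙ x⁺ - ℙ x⁻` in general. That `ℙ x` is the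
component of `x` in `B` for `E = B ⊕ Bᵈ` is proved below. -/
noncomputable def bandProj (B : Submodule ℝ E) (x : E) : E :=
  sSup {y : E | y ∈ B ∧ 0 ≤ y ∧ y ≤ x⁺} - sSup {y : E | y ∈ B ∧ 0 ≤ y ∧ y ≤ x⁻}

/-- `e` is a weak order unit of the band `B`: a positive element of `B` such that only `0` is
disjoint from it in `B`. -/
def IsWeakOrderUnitIn (B : Submodule ℝ E) (e : E) : Prop :=
  e ∈ B ∧ 0 ≤ e ∧ ∀ x ∈ B, |x| ⊓ e = 0 → x = 0

/-- The relation `x ≪ y`: the element `y - x` is a weak order unit of `E`. -/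
def WeakUnitLT (x y : E) : Prop :=
  IsWeakOrderUnitIn (⊤ : Submodule ℝ E) (y - x)

/-- The order open interval `(a, b) = {x : a ≪ x ≪ b}`. -/
def openInterval (a b : E) : Set E :=
  {x : E | WeakUnitLT a x ∧ WeakUnitLT x b}

/-- `B_{x < y}`: the largest band `B` for which `ℙ (y - x)` is a weak order unit in `B`. It is
written as the join of all such bands; that this join is itself such a band is proved below. -/
def bandLT (x y : E) : Submodule ℝ E :=
  sSup {B : Submodule ℝ E | IsBand B ∧ IsWeakOrderUnitIn B (bandProj B (y - x))}

/-- `f` with domain `s` is locally band preserving. -/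
def LocallyBandPreservingOn (f : E → E) (s : Set E) : Prop :=
  ∀ B : Submodule ℝ E, IsBand B → ∀ x ∈ s, ∀ y ∈ s,
    bandProj B x = bandProj B y → bandProj B (f x) = bandProj B (f y)

end Bands

section Continuity

variable {E : Type u} [Ring E] [Lattice E]

/-- Order convergence of a net: there is a set `Eps` with infimum `0` such that each `ε ∈ Eps`
eventually dominates `|x i - c|`. -/
def OrderTendsto {ι : Type u} [Preorder ι] (x : ι → E) (c : E) : Prop :=
  ∃ Eps : Set E, IsGLB Eps 0 ∧ ∀ ε ∈ Eps, ∃ i₀ : ι, ∀ i, i₀ ≤ i → |x i - c| ≤ ε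

/-- `f` with domain `s` is order continuous. Nets are indexed by nonempty directed sets in the
universe of `E`; index sets in other universes would give nothing more, since it suffices to test
on nets indexed by sets of pairs of elements of `E`. -/
def OrderContinuousOn (f : E → E) (s : Set E) : Prop :=
  ∀ c ∈ s, ∀ (ι : Type u) [Preorder ι] [Nonempty ι] [IsDirected ι (· ≤ ·)] (x : ι → E),
    (∀ i, x i ∈ s) → OrderTendsto x c → OrderTendsto (fun i => f (x i)) (f c)

/-- `f` with domain `s` is uniformly order continuous. -/
def UniformlyOrderContinuousOn (f : E → E) (s : Set E) : Prop :=
  ∀ (ι : Type u) [Preorder ι] [Nonempty ι] [IsDirected ι (· ≤ ·)] (x y : ι → E),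
    (∀ i, x i ∈ s) → (∀ i, y i ∈ s) → OrderTendsto (fun i => x i - y i) 0 →
      OrderTendsto (fun i => f (x i) - f (y i)) 0

/-- `D ↓ 0`: the set `D` is (nonempty and) downwards directed with infimum `0`. -/
def DecreasesToZero (D : Set E) : Prop :=
  D.Nonempty ∧ DirectedOn (· ≥ ·) D ∧ IsGLB D 0

end Continuity

section Derivative

variable {E : Type u} [Ring E] [ConditionallyCompleteLattice E] [Algebra ℝ E]

/-- `f` with domain `s` is order differentiable at `c` with derivative `f'`. -/
def HasOrderDerivAt (s : Set E) (f : E → E) (f' c : E) : Prop :=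
  ∃ r : E, WeakUnitLT 0 r ∧ openInterval (c - r) (c + r) ⊆ s ∧
    ∀ D : Set E, DecreasesToZero D → ∃ Eps : Set E, IsGLB Eps 0 ∧ ∀ ε ∈ Eps, ∃ δ ∈ D,
      ∀ x ∈ openInterval (c - r) (c + r), |x - c| ≤ δ →
        |f x - f c - (x - c) * f'| ≤ |x - c| * ε

/-- `f` with domain `s` is super order differentiable at `c` with derivative `f'`. -/
def HasSuperOrderDerivAt (s : Set E) (f : E → E) (f' c : E) : Prop :=
  ∃ r : E, WeakUnitLT 0 r ∧ openInterval (c - r) (c + r) ⊆ s ∧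
    ∀ D : Set E, DecreasesToZero D → ∃ Eps : Set E, IsGLB Eps 0 ∧ ∀ ε ∈ Eps, ∃ δ ∈ D,
      ∀ x ∈ s, |x - c| ≤ δ →
        |f x - f c - (x - c) * f'| ≤ |x - c| * ε

end Derivative

section Integral

variable {E : Type u} [Ring E] [ConditionallyCompleteLattice E]

/-- `a = x 0 ≤ x 1 ≤ ⋯ ≤ x n = b` is a partition of `[a, b]` (values beyond `n` are irrelevant). -/
def IsPartition (a b : E) (n : ℕ) (x : ℕ → E) : Prop :=
  x 0 = a ∧ x n = b ∧ ∀ i < n, x i ≤ x (i + 1)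

/-- The lower sum `∑ m_i (x_i - x_{i-1})`. -/
noncomputable def lowerSum (f : E → E) (n : ℕ) (x : ℕ → E) : E :=
  ∑ i ∈ Finset.range n, sInf (f '' Icc (x i) (x (i + 1))) * (x (i + 1) - x i)

/-- The upper sum `∑ M_i (x_i - x_{i-1})`. -/
noncomputable def upperSum (f : E → E) (n : ℕ) (x : ℕ → E) : E :=
  ∑ i ∈ Finset.range n, sSup (f '' Icc (x i) (x (i + 1))) * (x (i + 1) - x i)

/-- The lower integral of `f` over `[a, b]`. -/
noncomputable def lowerIntegral (f : E → E) (a b : E) : E :=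
  sSup {s : E | ∃ (n : ℕ) (x : ℕ → E), IsPartition a b n x ∧ s = lowerSum f n x}

/-- The upper integral of `f` over `[a, b]`. -/
noncomputable def upperIntegral (f : E → E) (a b : E) : E :=
  sInf {s : E | ∃ (n : ℕ) (x : ℕ → E), IsPartition a b n x ∧ s = upperSum f n x}

/-- `f` is integrable on `[a, b]`, where `a ≤ b`: it is order bounded there, and its upper and lower
integrals agree. -/
def IntegrableOnIcc (f : E → E) (a b : E) : Prop :=
  BddAbove (f '' Icc a b) ∧ BddBelow (f '' Icc a b) ∧ upperIntegral f a b = lowerIntegral f a b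

/-- `f` is integrable from `a` to `b`, for endpoints that need not be comparable. -/
def IntegrableFromTo (f : E → E) (a b : E) : Prop :=
  IntegrableOnIcc f (a ⊓ b) (a ⊔ b)

/-- The integral `∫_a^b f(x) dx`, for endpoints that need not be comparable:
`ℙ_{a<b} (∫_{a∧b}^{a∨b} f) - ℙ_{b<a} (∫_{a∧b}^{a∨b} f)`. -/
noncomputable def integral [Algebra ℝ E] (f : E → E) (a b : E) : E :=
  bandProj (bandLT a b) (upperIntegral f (a ⊓ b) (a ⊔ b)) -
    bandProj (bandLT b a) (upperIntegral f (a ⊓ b) (a ⊔ b))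

end Integral


section Facts

variable {E : Type u} [Ring E] [ConditionallyCompleteLattice E] [IsOrderedAddMonoid E]

theorem eq_zero_of_abs_eq_zero {x : E} (h : |x| = 0) : x = 0 :=
  le_antisymm (h ▸ le_abs_self x) (neg_nonpos.1 (h ▸ neg_le_abs x))

theorem inf_add_le_of_nonneg {x y z : E} (hx : 0 ≤ x) (hy : 0 ≤ y) (hz : 0 ≤ z) :
    x ⊓ (y + z) ≤ x ⊓ y + x ⊓ z := by
  rw [add_inf, inf_add, inf_add]
  refine le_inf (le_inf ?_ ?_) (le_inf ?_ ?_)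
  · exact inf_le_left.trans (le_add_of_nonneg_left hx)
  · exact inf_le_left.trans (le_add_of_nonneg_left hy)
  · exact inf_le_left.trans (le_add_of_nonneg_right hz)
  · exact inf_le_right

theorem disjoint_sub {x u v : E} (hu : |x| ⊓ |u| = 0) (hv : |x| ⊓ |v| = 0) :
    |x| ⊓ |u - v| = 0 := by
  refine le_antisymm ?_ (le_inf (abs_nonneg _) (abs_nonneg _))
  have h1 : |u - v| ≤ |u| + |v| := by simpa [sub_eq_add_neg] using abs_add_le u (-v)
  calc |x| ⊓ |u - v| ≤ |x| ⊓ (|u| + |v|) := inf_le_inf_left _ h1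
    _ ≤ |x| ⊓ |u| + |x| ⊓ |v| :=
      inf_add_le_of_nonneg (abs_nonneg _) (abs_nonneg _) (abs_nonneg _)
    _ = 0 := by rw [hu, hv, add_zero]

theorem disjoint_nsmul {x u : E} (n : ℕ) (h : |x| ⊓ |u| = 0) : |x| ⊓ n • |u| = 0 := by
  refine le_antisymm ?_ (le_inf (abs_nonneg _) (nsmul_nonneg (abs_nonneg _) _))
  induction n with
  | zero => rw [zero_smul]; exact inf_le_right
  | succ n ih =>
    rw [succ_nsmul]
    refine (inf_add_le_of_nonneg (abs_nonneg _) (nsmul_nonneg (abs_nonneg _) _)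
      (abs_nonneg _)).trans ?_
    rw [h, add_zero]
    exact ih

variable [Algebra ℝ E]

theorem bandProj_aux {B : Submodule ℝ E} (hB : IsBand B) {x : E} (hx : 0 ≤ x) :
    sSup {y : E | y ∈ B ∧ 0 ≤ y ∧ y ≤ x} ∈ B ∧ 0 ≤ sSup {y : E | y ∈ B ∧ 0 ≤ y ∧ y ≤ x} ∧
      sSup {y : E | y ∈ B ∧ 0 ≤ y ∧ y ≤ x} ≤ x ∧
      ∀ b ∈ B, |b| ⊓ |x - sSup {y : E | y ∈ B ∧ 0 ≤ y ∧ y ≤ x}| = 0 := by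
  set S : Set E := {y : E | y ∈ B ∧ 0 ≤ y ∧ y ≤ x} with hS
  have h0 : (0 : E) ∈ S := ⟨B.zero_mem, le_rfl, hx⟩
  have hlub : IsLUB S (sSup S) := isLUB_csSup ⟨0, h0⟩ ⟨x, fun y hy => hy.2.2⟩
  have hmem : sSup S ∈ B := hB.2 S (fun y hy => hy.1) _ hlub
  have hpos : 0 ≤ sSup S := hlub.1 h0
  have hle : sSup S ≤ x := hlub.2 fun y hy => hy.2.2
  refine ⟨hmem, hpos, hle, fun b hb => ?_⟩
  rw [abs_of_nonneg (sub_nonneg.2 hle)]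
  set v := |b| ⊓ (x - sSup S) with hv
  have hv0 : 0 ≤ v := le_inf (abs_nonneg _) (sub_nonneg.2 hle)
  have hvB : v ∈ B := hB.1 b hb v (by rw [abs_of_nonneg hv0]; exact inf_le_left)
  have h1 : v + sSup S ∈ S :=
    ⟨B.add_mem hvB hmem, add_nonneg hv0 hpos, by
      have : v ≤ x - sSup S := inf_le_right
      exact le_sub_iff_add_le.1 this⟩
  have h2 : v + sSup S ≤ sSup S := hlub.1 h1
  exact le_antisymm (by simpa using h2) hv0

/-- `bandProj B x` is the component of `x` in `B` for the decomposition `E = B ⊕ Bᵈ`. -/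
theorem bandProj_spec {B : Submodule ℝ E} (hB : IsBand B) (x : E) :
    bandProj B x ∈ B ∧ ∀ b ∈ B, |b| ⊓ |x - bandProj B x| = 0 := by
  obtain ⟨h1, -, -, h2⟩ := bandProj_aux hB (posPart_nonneg x)
  obtain ⟨h3, -, -, h4⟩ := bandProj_aux hB (negPart_nonneg x)
  refine ⟨B.sub_mem h1 h3, fun b hb => ?_⟩
  have h5 := disjoint_sub (h2 b hb) (h4 b hb)
  have h6 : x - bandProj B x =
      (x⁺ - sSup {y : E | y ∈ B ∧ 0 ≤ y ∧ y ≤ x⁺}) -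
        (x⁻ - sSup {y : E | y ∈ B ∧ 0 ≤ y ∧ y ≤ x⁻}) := by
    have h7 : ∀ u v p q : E, u - v - (p - q) = u - p - (v - q) := fun u v p q => by abel
    rw [← h7, posPart_sub_negPart x, bandProj]
  rw [h6]
  exact h5

/-- The component of `x` in `B` is unique. -/
theorem bandProj_eq {B : Submodule ℝ E} (hB : IsBand B) {x p : E} (hp : p ∈ B)
    (h : ∀ b ∈ B, |b| ⊓ |x - p| = 0) : bandProj B x = p := by
  obtain ⟨h1, h2⟩ := bandProj_spec hB x
  have h3 : p - bandProj B x ∈ B := B.sub_mem hp h1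
  have h4 := disjoint_sub (h2 _ h3) (h _ h3)
  rw [sub_sub_sub_cancel_left, inf_idem] at h4
  exact (sub_eq_zero.1 (eq_zero_of_abs_eq_zero h4)).symm

variable [IsOrderedModule ℝ E]

theorem abs_smul_le_nsmul (r : ℝ) (x : E) : ∃ n : ℕ, |r • x| ≤ n • |x| := by
  obtain ⟨n, hn⟩ := exists_nat_ge |r|
  refine ⟨n, ?_⟩
  have h1 : ∀ z : E, r • z ≤ n • |z| := by
    intro z
    have e1 : (n • |z| : E) = (n : ℝ) • |z| := (Nat.cast_smul_eq_nsmul ℝ n |z|).symm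
    have e2 : |r| • |z| ≤ (n : ℝ) • |z| := smul_le_smul_of_nonneg_right hn (abs_nonneg z)
    rw [e1]
    refine le_trans ?_ e2
    rcases le_total 0 r with hr | hr
    · rw [abs_of_nonneg hr]
      exact smul_le_smul_of_nonneg_left (le_abs_self z) hr
    · rw [abs_of_nonpos hr, ← neg_smul_neg]
      exact smul_le_smul_of_nonneg_left (neg_le_abs z) (neg_nonneg.2 hr)
  refine abs_le'.2 ⟨h1 x, ?_⟩
  have := h1 (-x)
  rwa [smul_neg, abs_neg] at this

/-- The disjoint complement of a set, as a linear subspace. -/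
def disjointCompl (W : Set E) : Submodule ℝ E where
  carrier := {z : E | ∀ w ∈ W, |w| ⊓ |z| = 0}
  zero_mem' := fun w _ => by rw [abs_zero]; exact inf_eq_right.2 (abs_nonneg w)
  add_mem' := fun {u v} hu hv w hw => by
    have := disjoint_sub (hu w hw) (v := -v) (by rw [abs_neg]; exact hv w hw)
    rwa [sub_neg_eq_add] at this
  smul_mem' := fun r z hz w hw => by
    obtain ⟨n, hn⟩ := abs_smul_le_nsmul r z
    refine le_antisymm ?_ (le_inf (abs_nonneg _) (abs_nonneg _))
    exact (inf_le_inf_left _ hn).trans (disjoint_nsmul n (hz w hw)).le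

theorem isBand_disjointCompl (W : Set E) : IsBand (disjointCompl W) := by
  refine ⟨fun x hx y hy w hw => ?_, fun S hS x hx w hw => ?_⟩
  · refine le_antisymm ?_ (le_inf (abs_nonneg _) (abs_nonneg _))
    exact (inf_le_inf_left _ hy).trans (hx w hw).le
  · rcases S.eq_empty_or_nonempty with rfl | ⟨s₀, hs₀⟩
    · have h0 : ∀ y : E, x ≤ y := fun y => hx.2 (by simp)
      have : |x| ≤ 0 := by
        refine abs_le'.2 ⟨h0 0, ?_⟩
        have := h0 (x + x)
        rw [le_add_iff_nonneg_left] at this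
        exact neg_nonpos.2 this
      exact le_antisymm (inf_le_right.trans this) (le_inf (abs_nonneg _) (abs_nonneg _))
    · -- the element `t = |w| ⊓ (x - s₀)` can be subtracted from the upper bound `x`
      have key : ∀ s ∈ S, |w| ⊓ |x - s| = 0 := by
        intro s hs
        have hsx : 0 ≤ x - s := sub_nonneg.2 (hx.1 hs)
        rw [abs_of_nonneg hsx]
        set t := |w| ⊓ (x - s) with ht
        have ht0 : 0 ≤ t := le_inf (abs_nonneg _) hsx
        have hb : x - t ∈ upperBounds S := by
          intro s' hs'
          have h1 : |w| ⊓ |s' - s| = 0 := disjoint_sub (hS hs' w hw) (hS hs w hw)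
          have h2 : t ⊓ (s' ⊔ s - s) ≤ 0 := by
            rw [← h1]
            refine inf_le_inf inf_le_left ?_
            rw [sup_sub, sub_self]
            exact sup_le (le_abs_self _) (abs_nonneg _)
          have h3 : 0 ≤ s' ⊔ s - s := sub_nonneg.2 le_sup_right
          have h4 : t + (s' ⊔ s - s) = t ⊔ (s' ⊔ s - s) := by
            rw [← inf_add_sup t (s' ⊔ s - s), le_antisymm h2 (le_inf ht0 h3), zero_add]
          have h5 : t + (s' ⊔ s - s) ≤ x - s := by
            rw [h4]
            exact sup_le inf_le_right (sub_le_sub_right (sup_le (hx.1 hs') (hx.1 hs)) _)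
          have h6 : t + s' ⊔ s ≤ x := by
            rw [← add_sub_assoc] at h5
            exact (sub_le_sub_iff_right s).1 h5
          exact le_sub_iff_add_le'.2 ((add_le_add_right le_sup_left t).trans h6)
        have h7 : x ≤ x - t := hx.2 hb
        exact le_antisymm (by simpa using h7) ht0
      have h8 := disjoint_sub (hS hs₀ w hw) (v := -(x - s₀)) (by rw [abs_neg]; exact key s₀ hs₀)
      have h9 : s₀ - -(x - s₀) = x := by abel
      rwa [h9] at h8

/-- `B_{x < y}` is the largest band `B` for which `ℙ (y - x)` is a weak order unit in `B`. -/
theorem isGreatest_bandLT (x y : E) :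
    IsGreatest {B : Submodule ℝ E | IsBand B ∧ IsWeakOrderUnitIn B (bandProj B (y - x))}
      (bandLT x y) := by
  set z := y - x with hz
  set W : Set E := {w : E | |w| ⊓ z⁺ = 0} with hW
  have hzp : |z⁺| = z⁺ := abs_of_nonneg (posPart_nonneg z)
  have hzn : |z⁻| = z⁻ := abs_of_nonneg (negPart_nonneg z)
  have hC := isBand_disjointCompl W
  have hmem : z⁺ ∈ disjointCompl W := fun w hw => by rw [hzp]; exact hw
  have hneg : z⁻ ∈ W := by
    show |z⁻| ⊓ z⁺ = 0
    rw [hzn, inf_comm]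
    exact posPart_inf_negPart_eq_zero z
  have hproj : bandProj (disjointCompl W) z = z⁺ := by
    refine bandProj_eq hC hmem fun b hb => ?_
    have : z - z⁺ = -z⁻ := by
      nth_rewrite 1 [← posPart_sub_negPart z]
      abel
    rw [this, abs_neg, inf_comm]
    exact hb _ hneg
  have hgr : IsGreatest {B : Submodule ℝ E | IsBand B ∧ IsWeakOrderUnitIn B (bandProj B z)}
      (disjointCompl W) := by
    refine ⟨⟨hC, ?_⟩, ?_⟩
    · rw [hproj]
      refine ⟨hmem, posPart_nonneg z, fun u hu h => ?_⟩
      have := hu u h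
      rw [inf_idem] at this
      exact eq_zero_of_abs_eq_zero this
    · rintro B ⟨hB, hp1, hp2, hp3⟩ u hu w hw
      obtain ⟨hs1, hs2⟩ := bandProj_spec hB z
      set p := bandProj B z with hp
      have hpz : p ≤ z⁺ := by
        -- `p = |p| ⊓ (p⁺)` and `z = p + q` with `p`, `q` disjoint
        have h1 := hs2 p hs1
        rw [abs_of_nonneg hp2] at h1
        have h2 : p ≤ z ⊔ 0 ⊔ p := le_sup_right
        have h3 : p ⊓ (z - p)⁻ = 0 :=
          le_antisymm ((inf_le_inf_left _ (by
            rw [negPart_def]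
            exact sup_le (neg_le_abs _) (abs_nonneg _))).trans h1.le)
            (le_inf hp2 (negPart_nonneg _))
        have h4 : p ≤ z⁺ + (z - p)⁻ := by
          have : p = z - (z - p) := by abel
          conv_lhs => rw [this]
          rw [sub_eq_add_neg]
          exact add_le_add (le_posPart z) (neg_le_negPart _)
        have h5 : p ≤ p ⊓ z⁺ + p ⊓ (z - p)⁻ :=
          (le_inf le_rfl h4).trans
            (inf_add_le_of_nonneg hp2 (posPart_nonneg _) (negPart_nonneg _))
        rw [h3, add_zero] at h5
        exact h5.trans inf_le_right
      have hv0 : 0 ≤ |w| ⊓ |u| := le_inf (abs_nonneg _) (abs_nonneg _)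
      refine hp3 _ (hB.1 u hu _ (by rw [abs_of_nonneg hv0]; exact inf_le_right)) ?_
      rw [abs_of_nonneg hv0]
      refine le_antisymm ?_ (le_inf hv0 hp2)
      have hw' : |w| ⊓ z⁺ = 0 := hw
      rw [← hw']
      exact inf_le_inf inf_le_left hpz
  have : bandLT x y = disjointCompl W := hgr.isLUB.sSup_eq
  rw [this]
  exact hgr

end Facts

end RieszIntegral

/-!
The algebraic part turns every notion of the statement into commutative algebra. A Dedekind complete
`Φ`-algebra is commutative (`mul_comm_of_isFAlgebra`) and reduced, multiplication by a positive
element preserves suprema and infima (`nonpos_of_forall_le_mul`, `mul_le_of_isLUB`), and every band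
projection is multiplication by an idempotent (`bandProj_eq_mul`), with enough idempotents to
compare any two elements band by band (`exists_idempotent_le`). Locally band preserving functions
are thus the functions `f` for which `e x = e y` implies `e f(x) = e f(y)` for idempotents `e`
(`IdempotentLocalOn`); such functions may be evaluated piecewise.

For these functions the upper Darboux integral is additive in the interval (`upperIntegral_add`),
although chains of partition points in `E` need not have a common refinement. Hence `f` is
integrable on subintervals, the integral between two points is an increment of the indefinite
integral `F` of `f` (`integral_eq_sub`), and continuity of `f` at `q` gives a first order expansion
of `F` at every point `q` of `[c, d]`, boundary points included (`abs_upperIntegral_sub_le`). By the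
chain rule `F ∘ G` has the derivative `(f ∘ G) g` on `(a, b)`, and the claim becomes the fundamental
theorem of calculus for `F ∘ G` (`upperIntegral_eq_sub`).

That theorem follows from the mean value inequality, proved by bisection: `[x, y]` contains nested
intervals of length `2⁻ⁿ (y - x)`, shrinking to a point `p`, on which `H` grows by at least
`2⁻ⁿ (H y - H x)` (`exists_nested_increments`). Which half is kept depends on the band, and locality
allows the choices to be glued. The expansion of `H` at `p` then gives `H y - H x ≤ M (y - x)`
whenever `M` dominates the derivative; since the radius `r` of differentiability at `p` is only a
weak order unit, this is checked on the bands where `2⁻ⁿ (y - x) ≤ r`, which exhaust `E`. All limits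
involved are limits along the scales `2⁻ⁿ z`, so order continuity and differentiability are used
only in that form.

The second part reduces to the first. A uniformly order continuous local function is bounded and
integrable, by uniform partitions, and `G` is locally band preserving because super
differentiability makes `e G` locally constant along real segments on which `e x` is constant
(`idempotentLocalOn_of_hasSuperOrderDerivAt`).
-/

namespace RieszIntegral

/-! ### Ordered ring structure and commutativity -/

section Noncommutative

variable {E : Type u} [Ring E] [ConditionallyCompleteLattice E] [IsOrderedAddMonoid E]

/-- Dedekind complete lattice-ordered groups are Archimedean. -/
theorem nonpos_of_forall_nsmul_le {x y : E} (h : ∀ n : ℕ, n • x ≤ y) : x ≤ 0 := by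
  have hlub : IsLUB (range fun n : ℕ => n • x) (sSup (range fun n : ℕ => n • x)) :=
    isLUB_csSup (range_nonempty _) ⟨y, by rintro _ ⟨n, rfl⟩; exact h n⟩
  have : sSup (range fun n : ℕ => n • x) ≤ sSup (range fun n : ℕ => n • x) - x := by
    refine hlub.2 ?_
    rintro _ ⟨n, rfl⟩
    have := hlub.1 ⟨n + 1, rfl⟩
    simp only [succ_nsmul] at this
    exact le_sub_iff_add_le.2 this
  simpa using this

variable [IsFAlgebra E]

omit [IsOrderedAddMonoid E] in
theorem mul_eq_zero_of_inf_eq_zero {x y : E} (h : x ⊓ y = 0) : x * y = 0 := by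
  have hx : 0 ≤ x := h ▸ inf_le_left
  have hy : 0 ≤ y := h ▸ inf_le_right
  have h1 := (IsFAlgebra.mul_inf_eq_zero x y y h hy).2
  rw [inf_comm] at h1
  have h2 := (IsFAlgebra.mul_inf_eq_zero y (x * y) x h1 hx).1
  rwa [inf_idem] at h2

theorem zero_le_one_of_isFAlgebra : (0 : E) ≤ 1 := by
  have h := mul_eq_zero_of_inf_eq_zero (posPart_inf_negPart_eq_zero (1 : E))
  have h1 : (1 : E)⁻ = -((1 : E)⁻ * (1 : E)⁻) := by
    have : ((1 : E)⁺ - (1 : E)⁻) * (1 : E)⁻ = (1 : E)⁻ := by rw [posPart_sub_negPart, one_mul]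
    rw [sub_mul, h, zero_sub] at this
    exact this.symm
  have h2 : (1 : E)⁻ ≤ 0 := by
    rw [h1]
    exact neg_nonpos.2 (IsFAlgebra.mul_nonneg _ _ (negPart_nonneg _) (negPart_nonneg _))
  exact negPart_eq_zero.1 (le_antisymm h2 (negPart_nonneg _))

instance isOrderedRing_of_isFAlgebra : IsOrderedRing E where
  zero_le_one := zero_le_one_of_isFAlgebra
  mul_le_mul_of_nonneg_left := fun a ha b c h => by
    have := IsFAlgebra.mul_nonneg a (c - b) ha (sub_nonneg.2 h)
    rwa [mul_sub, sub_nonneg] at this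
  mul_le_mul_of_nonneg_right := fun a ha b c h => by
    have := IsFAlgebra.mul_nonneg (c - b) a (sub_nonneg.2 h) ha
    rwa [sub_mul, sub_nonneg] at this

theorem anticommutator_inf_eq_zero {x u v : E} (hx : 0 ≤ x) (h : u ⊓ v = 0) :
    (x * u + u * x) ⊓ (x * v + v * x) = 0 := by
  have hu : 0 ≤ u := h ▸ inf_le_left
  have hv : 0 ≤ v := h ▸ inf_le_right
  have key : ∀ w, 0 ≤ w → w ⊓ v = 0 → w ⊓ (x * v + v * x) = 0 := fun w hw hwv => by
    refine le_antisymm ?_ (le_inf hw (add_nonneg (mul_nonneg hx hv) (mul_nonneg hv hx)))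
    refine (inf_add_le_of_nonneg hw (mul_nonneg hx hv) (mul_nonneg hv hx)).trans ?_
    rw [inf_comm] at hwv
    have := IsFAlgebra.mul_inf_eq_zero v w x hwv hx
    rw [inf_comm w, inf_comm w, this.1, this.2, add_zero]
  have h1 := key _ (mul_nonneg hx hu) (IsFAlgebra.mul_inf_eq_zero u v x h hx).1
  have h2 := key _ (mul_nonneg hu hx) (IsFAlgebra.mul_inf_eq_zero u v x h hx).2
  have h3 : 0 ≤ x * v + v * x := add_nonneg (mul_nonneg hx hv) (mul_nonneg hv hx)
  refine le_antisymm ?_ (le_inf (add_nonneg (mul_nonneg hx hu) (mul_nonneg hu hx)) h3)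
  rw [inf_comm]
  refine (inf_add_le_of_nonneg h3 (mul_nonneg hx hu) (mul_nonneg hu hx)).trans ?_
  rw [inf_comm, h1, inf_comm, h2, add_zero]

/-- For `x ≥ 0` the map `u ↦ x u + u x` preserves finite infima. -/
theorem anticommutator_inf_le {x u v : E} (hx : 0 ≤ x) :
    (x * u + u * x) ⊓ (x * v + v * x) ≤ x * (u ⊓ v) + (u ⊓ v) * x := by
  have h : (u - u ⊓ v) ⊓ (v - u ⊓ v) = 0 := by rw [← inf_sub, sub_self]
  have h1 := anticommutator_inf_eq_zero hx h
  have h2 : ∀ w, x * w + w * x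
      = (x * (w - u ⊓ v) + (w - u ⊓ v) * x) + (x * (u ⊓ v) + (u ⊓ v) * x) := fun w => by
    noncomm_ring
  rw [h2 u, h2 v, ← inf_add, h1, zero_add]

/-- Truncation at the level `n`: `x = (x ⊓ n) + (x - n)⁺` and the tail is small against `x²`. -/
theorem natCast_mul_posPart_sub_le {x : E} (hx : 0 ≤ x) (n : ℕ) :
    (n : E) * (x - n)⁺ ≤ x * x := by
  have h0 : (x - n)⁺ * (x - n)⁺ = (x - n) * (x - n)⁺ := by
    have h := mul_eq_zero_of_inf_eq_zero
      ((inf_comm _ _).trans (posPart_inf_negPart_eq_zero (x - n)))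
    have h' : ((x - n)⁺ - (x - n)⁻) * (x - n)⁺ = (x - n) * (x - n)⁺ := by
      rw [posPart_sub_negPart]
    rw [← h', sub_mul, h, sub_zero]
  have h1 : 0 ≤ (x - n) * (x - n)⁺ := h0 ▸ mul_nonneg (posPart_nonneg _) (posPart_nonneg _)
  have h2 : (n : E) * (x - n)⁺ ≤ x * (x - n)⁺ := by
    rw [sub_mul] at h1
    exact sub_nonneg.1 h1
  refine h2.trans (mul_le_mul_of_nonneg_left ?_ hx)
  exact sup_le (sub_le_self _ (Nat.cast_nonneg n)) hx

/-- The commutator with `y` does not see integer translations of `y`, so it is controlled by the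
distance of `y` to the nearest of the integers `0, …, m`. -/
theorem abs_commutator_le {x y : E} (hx : 0 ≤ x) (hy : 0 ≤ y) (m : ℕ) :
    |x * y - y * x| ≤ x * (1 + (y - m)⁺) + (1 + (y - m)⁺) * x := by
  have hS : ∀ u v : E, u ≤ v → x * u + u * x ≤ x * v + v * x := fun u v h =>
    add_le_add (mul_le_mul_of_nonneg_left h hx) (mul_le_mul_of_nonneg_right h hx)
  have hc : ∀ c : ℕ, |x * y - y * x| ≤ x * |y - c| + |y - c| * x := fun c => by
    have e : x * y - y * x = x * (y - c) - (y - c) * x := by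
      rw [mul_sub, sub_mul, (Nat.cast_commute c x).eq]
      abel
    have h1 : ∀ w : E, x * w - w * x ≤ x * |w| + |w| * x := fun w => by
      rw [sub_eq_add_neg, ← neg_mul]
      exact add_le_add (mul_le_mul_of_nonneg_left (le_abs_self _) hx)
        (mul_le_mul_of_nonneg_right (neg_le_abs _) hx)
    rw [e]
    refine abs_le'.2 ⟨h1 _, ?_⟩
    have := h1 (-(y - c))
    rw [abs_neg] at this
    refine le_trans (le_of_eq ?_) this
    noncomm_ring
  induction m with
  | zero =>
    refine (hc 0).trans (hS _ _ ?_)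
    rw [Nat.cast_zero, sub_zero, abs_of_nonneg hy, posPart_of_nonneg hy]
    exact le_add_of_nonneg_left zero_le_one
  | succ m ih =>
    refine (le_inf ih (hc (m + 1))).trans ((anticommutator_inf_le hx).trans (hS _ _ ?_))
    rw [Nat.cast_succ, ← sub_sub]
    set w := y - (m : E)
    have h1 : w⁺ ≤ (w - 1)⁺ + w⁺ := le_add_of_nonneg_left (posPart_nonneg _)
    have h2 : |w - 1| ≤ (w - 1)⁺ + (1 + w⁻) := by
      rw [← posPart_add_negPart]
      refine add_le_add le_rfl (sup_le ?_ (add_nonneg zero_le_one (negPart_nonneg _)))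
      rw [neg_sub, sub_eq_add_neg]
      exact add_le_add le_rfl (neg_le_negPart _)
    calc (1 + w⁺) ⊓ |w - 1|
        ≤ (1 + (w - 1)⁺ + w⁺) ⊓ (1 + (w - 1)⁺ + w⁻) := by
          refine inf_le_inf ?_ (h2.trans_eq (by abel))
          rw [add_assoc]
          exact add_le_add le_rfl h1
      _ = 1 + (w - 1)⁺ := by rw [← add_inf, posPart_inf_negPart_eq_zero, add_zero]

theorem commute_of_nonneg {x y : E} (hx : 0 ≤ x) (hy : 0 ≤ y) : x * y = y * x := by
  have key : ∀ y : E, 0 ≤ y → |x * y - y * x| ≤ x + x := by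
    intro y hy
    rw [← sub_nonpos]
    refine nonpos_of_forall_nsmul_le (y := x * (y * y) + (y * y) * x) fun m => ?_
    have h1 := abs_commutator_le hx hy m
    have h2 := natCast_mul_posPart_sub_le hy m
    have h3 : |x * y - y * x| - (x + x) ≤ x * (y - m)⁺ + (y - m)⁺ * x := by
      rw [sub_le_iff_le_add]
      refine h1.trans_eq ?_
      noncomm_ring
    refine (nsmul_le_nsmul_right h3 m).trans ?_
    have e : m • (x * (y - m)⁺ + (y - m)⁺ * x)
        = x * ((m : E) * (y - m)⁺) + ((m : E) * (y - m)⁺) * x := by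
      simp only [← nsmul_eq_mul, smul_add, mul_smul_comm, smul_mul_assoc]
    rw [e]
    exact add_le_add (mul_le_mul_of_nonneg_left h2 hx) (mul_le_mul_of_nonneg_right h2 hx)
  have h0 : ∀ n : ℕ, x * (n • y) - (n • y) * x = n • (x * y - y * x) := fun n => by
    simp only [smul_sub, mul_smul_comm, smul_mul_assoc]
  refine le_antisymm (sub_nonpos.1 ?_) (sub_nonpos.1 ?_) <;>
    refine nonpos_of_forall_nsmul_le (y := x + x) fun n => ?_
  · rw [← h0]
    exact (le_abs_self _).trans (key _ (nsmul_nonneg hy n))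
  · rw [← neg_sub, smul_neg, ← h0]
    exact (neg_le_abs _).trans (key _ (nsmul_nonneg hy n))

/-- Dedekind complete (indeed, Archimedean) `Φ`-algebras are commutative. -/
theorem mul_comm_of_isFAlgebra (x y : E) : x * y = y * x := by
  rw [← posPart_sub_negPart x, ← posPart_sub_negPart y]
  simp only [sub_mul, mul_sub]
  rw [commute_of_nonneg (posPart_nonneg x) (posPart_nonneg y),
    commute_of_nonneg (posPart_nonneg x) (negPart_nonneg y),
    commute_of_nonneg (negPart_nonneg x) (posPart_nonneg y),
    commute_of_nonneg (negPart_nonneg x) (negPart_nonneg y)]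
  abel

end Noncommutative

/-! ### Lattice properties of the multiplication -/

section Multiplication

variable {E : Type u} [CommRing E] [ConditionallyCompleteLattice E] [IsOrderedAddMonoid E]

theorem posPart_sub_of_inf_eq_zero {p q : E} (h : p ⊓ q = 0) : (p - q)⁺ = p := by
  have h1 := inf_add_sup p q
  rw [h, zero_add] at h1
  rw [posPart_def, ← sub_self q, ← sup_sub, h1, add_sub_cancel_right]

variable [IsFAlgebra E]

theorem posPart_mul_negPart (x : E) : x⁺ * x⁻ = 0 :=
  mul_eq_zero_of_inf_eq_zero (posPart_inf_negPart_eq_zero x)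

omit [IsOrderedAddMonoid E] in
theorem mul_inf_mul_eq_zero {k p q : E} (hk : 0 ≤ k) (h : p ⊓ q = 0) : (k * p) ⊓ (k * q) = 0 := by
  have h1 := (IsFAlgebra.mul_inf_eq_zero p q k h hk).1
  rw [inf_comm] at h1
  rw [inf_comm]
  exact (IsFAlgebra.mul_inf_eq_zero q (k * p) k h1 hk).1

theorem posPart_mul_of_nonneg {k : E} (hk : 0 ≤ k) (u : E) : (k * u)⁺ = k * u⁺ := by
  conv_lhs => rw [← posPart_sub_negPart u, mul_sub]
  exact posPart_sub_of_inf_eq_zero (mul_inf_mul_eq_zero hk (posPart_inf_negPart_eq_zero u))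

theorem abs_mul_of_nonneg {k : E} (hk : 0 ≤ k) (u : E) : |k * u| = k * |u| := by
  rw [← posPart_add_negPart, ← posPart_add_negPart u, ← posPart_neg, ← posPart_neg, ← mul_neg,
    posPart_mul_of_nonneg hk, posPart_mul_of_nonneg hk, mul_add]

theorem mul_inf_of_nonneg {k : E} (hk : 0 ≤ k) (u v : E) : k * (u ⊓ v) = (k * u) ⊓ (k * v) := by
  rw [inf_eq_sub_posPart_sub, inf_eq_sub_posPart_sub (k * u), ← mul_sub k u v,
    posPart_mul_of_nonneg hk, mul_sub]

theorem abs_mul_le (x y : E) : |x * y| ≤ |x| * |y| := by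
  have h1 : |x * y| ≤ |x⁺ * y| + |x⁻ * y| := by
    conv_lhs => rw [← posPart_sub_negPart x, sub_mul, sub_eq_add_neg]
    refine (abs_add_le _ _).trans_eq ?_
    rw [abs_neg]
  rwa [abs_mul_of_nonneg (posPart_nonneg x), abs_mul_of_nonneg (negPart_nonneg x), ← add_mul,
    posPart_add_negPart] at h1

theorem mul_self_nonneg_of_isFAlgebra (x : E) : 0 ≤ x * x := by
  have h : x * x = x⁺ * x⁺ + x⁻ * x⁻ := by
    have h0 := posPart_mul_negPart x
    have h1 := posPart_sub_negPart x
    linear_combination (-x - (x⁺ - x⁻)) * h1 - 2 * h0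
  rw [h]
  exact add_nonneg (mul_nonneg (posPart_nonneg _) (posPart_nonneg _))
    (mul_nonneg (negPart_nonneg _) (negPart_nonneg _))

/-- Unital Archimedean `f`-algebras are reduced. -/
theorem eq_zero_of_mul_self_eq_zero {x : E} (hx : 0 ≤ x) (h : x * x = 0) : x = 0 := by
  refine le_antisymm (nonpos_of_forall_nsmul_le (y := 1) fun n => ?_) hx
  have h1 := mul_self_nonneg_of_isFAlgebra ((n : E) * x - 1)
  have h2 : ((n : E) * x - 1) * ((n : E) * x - 1) = 1 - (n * x + n * x) := by
    linear_combination ((n : E) * n) * h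
  rw [h2, sub_nonneg] at h1
  rw [nsmul_eq_mul]
  exact (le_add_of_nonneg_left (mul_nonneg (Nat.cast_nonneg n) hx)).trans h1

theorem inf_eq_zero_of_mul_eq_zero {u v : E} (hu : 0 ≤ u) (hv : 0 ≤ v) (h : u * v = 0) :
    u ⊓ v = 0 := by
  have h0 : 0 ≤ u ⊓ v := le_inf hu hv
  refine eq_zero_of_mul_self_eq_zero h0 (le_antisymm ?_ (mul_nonneg h0 h0))
  rw [← h]
  exact mul_le_mul inf_le_left inf_le_right h0 hu

theorem abs_mul_eq_zero {u k : E} (hk : 0 ≤ k) (h : u * k = 0) : |u| * k = 0 := by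
  rw [mul_comm, ← abs_mul_of_nonneg hk, mul_comm, h, abs_zero]

theorem mul_eq_zero_of_abs_mul {u k : E} (hk : 0 ≤ k) (h : |u| * k = 0) : u * k = 0 := by
  rw [mul_comm, ← abs_mul_of_nonneg hk, mul_comm] at h
  exact eq_zero_of_abs_eq_zero h

theorem mul_eq_zero_of_le {u v k l : E} (hu : 0 ≤ u) (huv : u ≤ v) (hk : 0 ≤ k) (hkl : k ≤ l)
    (h : v * l = 0) : u * k = 0 :=
  le_antisymm (h ▸ mul_le_mul huv hkl hk (hu.trans huv)) (mul_nonneg hu hk)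

end Multiplication

section OrderContinuity

variable {E : Type u} [CommRing E] [ConditionallyCompleteLattice E] [IsOrderedAddMonoid E]
  [IsFAlgebra E] [Algebra ℝ E] [IsOrderedModule ℝ E]

omit [IsOrderedAddMonoid E] [IsFAlgebra E] in
theorem nonpos_of_forall_le_nsmul {A : Set E} (hA : IsGLB A 0) {w : E} (n : ℕ)
    (h : ∀ ε ∈ A, w ≤ n • ε) : w ≤ 0 := by
  rcases Nat.eq_zero_or_pos n with rfl | hn
  · rcases A.eq_empty_or_nonempty with rfl | ⟨ε, hε⟩
    · exact hA.2 (by simp)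
    · simpa using h ε hε
  · have hn' : (0 : ℝ) < n := Nat.cast_pos.2 hn
    have h1 : ((n : ℝ)⁻¹) • w ≤ 0 := hA.2 fun ε hε => by
      have := smul_le_smul_of_nonneg_left (h ε hε) (inv_nonneg.2 hn'.le)
      rwa [← Nat.cast_smul_eq_nsmul ℝ, smul_smul, inv_mul_cancel₀ hn'.ne', one_smul] at this
    have h2 := smul_le_smul_of_nonneg_left h1 hn'.le
    rwa [smul_smul, mul_inv_cancel₀ hn'.ne', one_smul, smul_zero] at h2

/-- Multiplication by a positive element is order continuous at `0`. -/
theorem nonpos_of_forall_le_mul {A : Set E} (hA : IsGLB A 0) {k w : E} (hk : 0 ≤ k)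
    (h : ∀ ε ∈ A, w ≤ k * ε) : w ≤ 0 := by
  rcases A.eq_empty_or_nonempty with rfl | ⟨ε₀, hε₀⟩
  · exact hA.2 (by simp)
  have h0 : 0 ≤ ε₀ := hA.1 hε₀
  refine nonpos_of_forall_nsmul_le (y := k * k * ε₀) fun n => ?_
  rw [← sub_nonpos]
  refine nonpos_of_forall_le_nsmul hA (n * n) fun ε hε => ?_
  have hε0 : 0 ≤ ε := hA.1 hε
  have h1 : w ≤ k * (ε ⊓ ε₀) := by
    rw [mul_inf_of_nonneg hk]
    exact le_inf (h ε hε) (h ε₀ hε₀)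
  have h2 : k ≤ n + (k - n)⁺ := by
    rw [← sub_le_iff_le_add']
    exact le_posPart _
  have h3 : w ≤ n * ε + (k - n)⁺ * ε₀ := by
    refine h1.trans ((mul_le_mul_of_nonneg_right h2 (le_inf hε0 h0)).trans ?_)
    rw [add_mul]
    exact add_le_add (mul_le_mul_of_nonneg_left inf_le_left (Nat.cast_nonneg n))
      (mul_le_mul_of_nonneg_left inf_le_right (posPart_nonneg _))
  have h4 : (n : E) * w ≤ n * (n * ε + (k - n)⁺ * ε₀) :=
    mul_le_mul_of_nonneg_left h3 (Nat.cast_nonneg n)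
  have h5 := mul_le_mul_of_nonneg_right (natCast_mul_posPart_sub_le hk n) h0
  rw [nsmul_eq_mul, nsmul_eq_mul, Nat.cast_mul]
  linear_combination h4 + h5

theorem isGLB_mul_add_mul {A B : Set E} (hA : IsGLB A 0) (hB : IsGLB B 0) {k l : E} (hk : 0 ≤ k)
    (hl : 0 ≤ l) : IsGLB {w : E | ∃ ε ∈ A, ∃ η ∈ B, w = k * ε + l * η} 0 := by
  refine ⟨?_, fun w hw => ?_⟩
  · rintro _ ⟨ε, hε, η, hη, rfl⟩
    exact add_nonneg (mul_nonneg hk (hA.1 hε)) (mul_nonneg hl (hB.1 hη))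
  · refine nonpos_of_forall_le_mul hB hl fun η hη => ?_
    rw [← sub_nonpos]
    refine nonpos_of_forall_le_mul hA hk fun ε hε => ?_
    rw [sub_le_iff_le_add]
    exact hw ⟨ε, hε, η, hη, rfl⟩

/-- Multiplication by a positive element preserves suprema. -/
theorem mul_le_of_isLUB {S : Set E} {m k t : E} (hS : IsLUB S m) (hk : 0 ≤ k)
    (h : ∀ s ∈ S, s * k ≤ t) : m * k ≤ t := by
  have hA : IsGLB ((fun s => m - s) '' S) 0 := by
    refine ⟨?_, fun l hl => ?_⟩
    · rintro _ ⟨s, hs, rfl⟩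
      exact sub_nonneg.2 (hS.1 hs)
    · have : m ≤ m - l := hS.2 fun s hs => le_sub_comm.1 (hl ⟨s, hs, rfl⟩)
      simpa using this
  rw [← sub_nonpos]
  refine nonpos_of_forall_le_mul hA hk ?_
  rintro _ ⟨s, hs, rfl⟩
  linear_combination h s hs

end OrderContinuity

/-! ### Band projections as multiplications by idempotents -/

section Idempotents

variable {E : Type u} [CommRing E] [ConditionallyCompleteLattice E] [IsOrderedAddMonoid E]
  [IsFAlgebra E]

theorem idempotent_nonneg {e : E} (he : e * e = e) : 0 ≤ e :=
  he ▸ mul_self_nonneg_of_isFAlgebra e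

omit [ConditionallyCompleteLattice E] [IsOrderedAddMonoid E] [IsFAlgebra E] in
theorem idempotent_compl {e : E} (he : e * e = e) : (1 - e) * (1 - e) = 1 - e := by
  linear_combination he

variable [Algebra ℝ E]

/-- The band projection onto `B` is multiplication by the component of `1` in `B`. -/
theorem bandProj_eq_mul {B : Submodule ℝ E} (hB : IsBand B) (v : E) :
    bandProj B v = bandProj B 1 * v := by
  refine bandProj_eq hB ?_ fun b hb => ?_
  · obtain ⟨hq, hd⟩ := bandProj_spec hB (bandProj B 1 * v)
    set q := bandProj B (bandProj B 1 * v)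
    set t := bandProj B 1 * v - q with ht
    have h1 : |bandProj B 1| * |t| = 0 :=
      mul_eq_zero_of_inf_eq_zero (hd _ (bandProj_spec hB 1).1)
    have h2 : |q| * |t| = 0 := mul_eq_zero_of_inf_eq_zero (hd _ hq)
    have h3 : t * |t| = 0 := by
      have h4 := mul_eq_zero_of_abs_mul (abs_nonneg _) h1
      have h5 := mul_eq_zero_of_abs_mul (abs_nonneg _) h2
      calc t * |t| = v * (bandProj B 1 * |t|) - q * |t| := by rw [ht]; ring
        _ = 0 := by rw [h4, h5, mul_zero, sub_zero]
    have h6 := eq_zero_of_abs_eq_zero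
      (eq_zero_of_mul_self_eq_zero (abs_nonneg _) (abs_mul_eq_zero (abs_nonneg _) h3))
    rw [show bandProj B 1 * v = q from sub_eq_zero.1 h6]
    exact hq
  · have h := (bandProj_spec hB 1).2 b hb
    rw [inf_comm] at h
    have h1 := (IsFAlgebra.mul_inf_eq_zero _ _ |v| h (abs_nonneg v)).1
    refine le_antisymm ?_ (le_inf (abs_nonneg _) (abs_nonneg _))
    rw [inf_comm, ← h1]
    refine inf_le_inf_right _ ?_
    refine (le_of_eq ?_).trans (abs_mul_le _ _)
    congr 1
    ring

theorem bandProj_one_idempotent {B : Submodule ℝ E} (hB : IsBand B) :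
    bandProj B 1 * bandProj B 1 = bandProj B 1 := by
  rw [← bandProj_eq_mul hB]
  refine bandProj_eq hB (bandProj_spec hB 1).1 fun b _ => ?_
  rw [sub_self, abs_zero]
  exact inf_eq_right.2 (abs_nonneg b)

theorem bandProj_one_mul {B : Submodule ℝ E} (hB : IsBand B) {x : E} (hx : x ∈ B) :
    bandProj B 1 * x = x := by
  rw [← bandProj_eq_mul hB]
  refine bandProj_eq hB hx fun b _ => ?_
  rw [sub_self, abs_zero]
  exact inf_eq_right.2 (abs_nonneg b)

/-- The range of the multiplication by an idempotent, as a subspace. -/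
def idempotentBand (e : E) : Submodule ℝ E where
  carrier := {x | e * x = x}
  zero_mem' := mul_zero e
  add_mem' := fun {x y} hx hy => by
    change e * (x + y) = x + y
    rw [mul_add, show e * x = x from hx, show e * y = y from hy]
  smul_mem' := fun r x hx => by
    change e * (r • x) = r • x
    rw [mul_smul_comm, show e * x = x from hx]

theorem isBand_idempotentBand {e : E} (he : e * e = e) : IsBand (idempotentBand e) := by
  have h0 := idempotent_nonneg (idempotent_compl he)
  have hmem : ∀ x : E, x ∈ idempotentBand e ↔ (1 - e) * x = 0 := fun x => by
    change e * x = x ↔ _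
    rw [sub_mul, one_mul, sub_eq_zero, eq_comm]
  refine ⟨fun x hx y hxy => ?_, fun S hS x hx => ?_⟩
  · rw [hmem] at hx ⊢
    refine eq_zero_of_abs_eq_zero (le_antisymm ?_ (abs_nonneg _))
    rw [abs_mul_of_nonneg h0]
    refine (mul_le_mul_of_nonneg_left hxy h0).trans ?_
    rw [← abs_mul_of_nonneg h0, hx, abs_zero]
  · have h1 : x ≤ e * x := hx.2 fun t ht => by
      have : e * t = t := hS ht
      rw [← this]
      exact mul_le_mul_of_nonneg_left (hx.1 ht) (idempotent_nonneg he)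
    rw [hmem]
    refine le_antisymm (by rw [sub_mul, one_mul]; exact sub_nonpos.2 h1) ?_
    rcases S.eq_empty_or_nonempty with rfl | ⟨t, ht⟩
    · -- the supremum of the empty set is a least element, which exists only in the zero algebra
      have h2 : ∀ y : E, x ≤ y := fun y => hx.2 (by simp)
      have h3 : ∀ y : E, 0 ≤ y := fun y => by simpa using h2 (x + y)
      exact h3 _
    · have h2 := mul_le_mul_of_nonneg_left (hx.1 ht) h0
      rwa [(hmem t).1 (hS ht)] at h2

theorem bandProj_idempotentBand {e : E} (he : e * e = e) (x : E) :
    bandProj (idempotentBand e) x = e * x := by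
  refine bandProj_eq (isBand_idempotentBand he) (show e * (e * x) = e * x by
    rw [← mul_assoc, he]) fun b hb => ?_
  have hb' : e * |b| = |b| := by
    rw [← abs_mul_of_nonneg (idempotent_nonneg he), show e * b = b from hb]
  rw [inf_comm]
  refine inf_eq_zero_of_mul_eq_zero (abs_nonneg _) (abs_nonneg _)
    (abs_mul_eq_zero (abs_nonneg _) ?_)
  linear_combination (-(x - e * x)) * hb' - x * |b| * he

variable [IsOrderedModule ℝ E]

/-- The support of a positive element `z`: the smallest idempotent `e` with `e z = z`. -/
theorem exists_support {z : E} (hz : 0 ≤ z) :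
    ∃ e : E, e * e = e ∧ e * z = z ∧ ∀ u, u * z = 0 → u * e = 0 := by
  set B := disjointCompl {w : E | |w| ⊓ z = 0} with hB_def
  have hB : IsBand B := isBand_disjointCompl _
  refine ⟨bandProj B 1, bandProj_one_idempotent hB, bandProj_one_mul hB ?_, fun u hu => ?_⟩
  · intro w hw
    rwa [abs_of_nonneg hz]
  · have h1 : |u| ⊓ z = 0 :=
      inf_eq_zero_of_mul_eq_zero (abs_nonneg u) hz (abs_mul_eq_zero hz hu)
    have h2 := mul_eq_zero_of_inf_eq_zero ((bandProj_spec hB 1).1 u h1)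
    rw [abs_of_nonneg (idempotent_nonneg (bandProj_one_idempotent hB))] at h2
    exact mul_eq_zero_of_abs_mul (idempotent_nonneg (bandProj_one_idempotent hB)) h2

/-- Comparison with `0`: every element is positive on the support of its positive part and negative
on the complement. -/
theorem exists_idempotent_mul_eq_posPart (x : E) :
    ∃ e : E, e * e = e ∧ e * x = x⁺ ∧ ∀ u, u * x⁺ = 0 → u * e = 0 := by
  obtain ⟨e, he, hex, hu⟩ := exists_support (posPart_nonneg x)
  refine ⟨e, he, ?_, hu⟩
  have h1 := hu x⁻ (by rw [mul_comm]; exact posPart_mul_negPart x)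
  have h2 := posPart_sub_negPart x
  linear_combination (-e) * h2 + hex - h1

theorem abs_mul_abs_eq_zero {k x : E} (h : k * x = 0) : |k| * |x| = 0 := by
  obtain ⟨e, -, hex, -⟩ := exists_idempotent_mul_eq_posPart x
  refine abs_mul_eq_zero (abs_nonneg _) ?_
  have h1 := posPart_add_negPart x
  have h2 := posPart_sub_negPart x
  linear_combination (2 * e - 1) * h - 2 * k * hex - k * h1 - k * h2

theorem exists_idempotent_le (x y : E) :
    ∃ e : E, e * e = e ∧ e * x ≤ e * y ∧ (1 - e) * y ≤ (1 - e) * x := by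
  obtain ⟨e, he, hex, -⟩ := exists_idempotent_mul_eq_posPart (y - x)
  refine ⟨e, he, ?_, ?_⟩
  · rw [← sub_nonneg, ← mul_sub, hex]
    exact posPart_nonneg _
  · rw [← sub_nonneg, ← mul_sub]
    have h2 := posPart_sub_negPart (y - x)
    have : (1 - e) * (x - y) = (y - x)⁻ := by linear_combination h2 + hex
    rw [this]
    exact negPart_nonneg _

omit [IsOrderedModule ℝ E] in
theorem weakUnitLT_iff {x y : E} :
    WeakUnitLT x y ↔ x ≤ y ∧ ∀ u, u * (y - x) = 0 → u = 0 := by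
  constructor
  · rintro ⟨-, h0, h⟩
    refine ⟨sub_nonneg.1 h0, fun u hu => h u trivial ?_⟩
    exact inf_eq_zero_of_mul_eq_zero (abs_nonneg u) h0 (abs_mul_eq_zero h0 hu)
  · rintro ⟨h0, h⟩
    refine ⟨trivial, sub_nonneg.2 h0, fun u _ hu => h u ?_⟩
    exact mul_eq_zero_of_abs_mul (sub_nonneg.2 h0) (mul_eq_zero_of_inf_eq_zero hu)

/-- The band projection onto `B_{x < y}` is multiplication by an idempotent that cuts `y - x` down
to its positive part. -/
theorem exists_bandProj_bandLT (x y : E) :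
    ∃ e : E, 0 ≤ e ∧ e * (y - x) = (y - x)⁺ ∧ ∀ v, bandProj (bandLT x y) v = e * v := by
  obtain ⟨⟨hB, h1, h2, -⟩, hmax⟩ := isGreatest_bandLT x y
  obtain ⟨s, hs, hsx, hu⟩ := exists_idempotent_mul_eq_posPart (y - x)
  have hle : idempotentBand s ≤ bandLT x y := by
    refine hmax ⟨isBand_idempotentBand hs, ?_⟩
    rw [bandProj_idempotentBand hs, hsx]
    refine ⟨?_, posPart_nonneg _, fun u hu' h => ?_⟩
    · change s * (y - x)⁺ = (y - x)⁺
      rw [← hsx, ← mul_assoc, hs]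
    · have h3 := hu u (mul_eq_zero_of_abs_mul (posPart_nonneg _) (mul_eq_zero_of_inf_eq_zero h))
      rwa [mul_comm, show s * u = u from hu'] at h3
  have he := idempotent_nonneg (bandProj_one_idempotent hB)
  refine ⟨bandProj (bandLT x y) 1, he, ?_, bandProj_eq_mul hB⟩
  have hes : (y - x)⁺ ∈ bandLT x y := hle (show s * (y - x)⁺ = (y - x)⁺ by
    rw [← hsx, ← mul_assoc, hs])
  rw [bandProj_eq_mul hB] at h2
  rw [← posPart_of_nonneg h2, posPart_mul_of_nonneg he, bandProj_one_mul hB hes]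

/-- The local form of `LocallyBandPreservingOn`: the values of `f` on the support of an idempotent
depend only on the argument there. -/
def IdempotentLocalOn (f : E → E) (s : Set E) : Prop :=
  ∀ e : E, e * e = e → ∀ x ∈ s, ∀ y ∈ s, e * x = e * y → e * f x = e * f y

omit [IsOrderedModule ℝ E] in
theorem LocallyBandPreservingOn.idempotentLocalOn {f : E → E} {s : Set E}
    (hf : LocallyBandPreservingOn f s) : IdempotentLocalOn f s := by
  intro e he x hx y hy hxy
  have h := hf (idempotentBand e) (isBand_idempotentBand he) x hx y hy
  simp only [bandProj_idempotentBand he] at h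
  exact h hxy

theorem IdempotentLocalOn.mul_eq_mul {f : E → E} {s : Set E} (hf : IdempotentLocalOn f s)
    {p q l : E} (hp : p ∈ s) (hq : q ∈ s) (hl : 0 ≤ l) (h : (p - q) * l = 0) :
    f p * l = f q * l := by
  obtain ⟨e, he, hel, hu⟩ := exists_support hl
  have h1 := hf e he p hp q hq (by linear_combination hu _ h)
  linear_combination l * h1 - (f p - f q) * hel

end Idempotents

/-! ### Darboux sums and their additivity -/

section Darboux

variable {E : Type u} [CommRing E] [ConditionallyCompleteLattice E] {a b u c d K : E} {f : E → E}

omit [CommRing E] in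
theorem IsPartition.le {n : ℕ} {x : ℕ → E} (hx : IsPartition a b n x) {i j : ℕ} (hij : i ≤ j)
    (hj : j ≤ n) : x i ≤ x j := by
  induction j, hij using Nat.le_induction with
  | base => exact le_rfl
  | succ j _ ih => exact (ih (by omega)).trans (hx.2.2 j (by omega))

omit [CommRing E] in
theorem IsPartition.mem {n : ℕ} {x : ℕ → E} (hx : IsPartition a b n x) {i : ℕ} (hi : i ≤ n) :
    x i ∈ Icc a b :=
  ⟨hx.1 ▸ hx.le (Nat.zero_le i) hi, hx.2.1 ▸ hx.le hi le_rfl⟩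

omit [CommRing E] in
theorem isPartition_trivial (hab : a ≤ b) :
    IsPartition a b 1 (fun i => if i = 0 then a else b) := by
  refine ⟨rfl, rfl, fun i hi => ?_⟩
  obtain rfl : i = 0 := by omega
  simpa using hab

theorem IsPartition.append {n m : ℕ} {x y : ℕ → E} (hx : IsPartition a u n x)
    (hy : IsPartition u b m y) (f : E → E) :
    ∃ z, IsPartition a b (n + m) z ∧ upperSum f (n + m) z = upperSum f n x + upperSum f m y := by
  set z : ℕ → E := fun i => if i ≤ n then x i else y (i - n) with hz
  have h1 : ∀ i, i ≤ n → z i = x i := fun i hi => if_pos hi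
  have h2 : ∀ i, z (n + i) = y i := fun i => by
    rcases Nat.eq_zero_or_pos i with rfl | hi
    · rw [add_zero, h1 n le_rfl, hx.2.1, hy.1]
    · simp only [hz, if_neg (show ¬ n + i ≤ n by omega), Nat.add_sub_cancel_left]
  refine ⟨z, ⟨(h1 0 (Nat.zero_le _)).trans hx.1, (h2 m).trans hy.2.1, fun i hi => ?_⟩, ?_⟩
  · rcases lt_or_ge i n with h | h
    · rw [h1 i h.le, h1 (i + 1) h]
      exact hx.2.2 i h
    · obtain ⟨k, rfl⟩ := Nat.exists_eq_add_of_le h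
      rw [add_assoc, h2, h2]
      exact hy.2.2 k (by omega)
  · unfold upperSum
    rw [Finset.sum_range_add]
    congr 1
    · refine Finset.sum_congr rfl fun i hi => ?_
      have := Finset.mem_range.1 hi
      rw [h1 i this.le, h1 (i + 1) this]
    · refine Finset.sum_congr rfl fun i _ => ?_
      rw [add_assoc, h2, h2]

variable [IsOrderedAddMonoid E]

omit [IsOrderedAddMonoid E] in
theorem bddAbove_image_of_abs_le {s : Set E} (hK : ∀ x ∈ s, |f x| ≤ K) : BddAbove (f '' s) :=
  ⟨K, by rintro _ ⟨x, hx, rfl⟩; exact (le_abs_self _).trans (hK x hx)⟩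

theorem bddBelow_image_of_abs_le {s : Set E} (hK : ∀ x ∈ s, |f x| ≤ K) : BddBelow (f '' s) :=
  ⟨-K, by rintro _ ⟨x, hx, rfl⟩; exact neg_le.1 ((neg_le_abs _).trans (hK x hx))⟩

theorem exists_abs_le_of_bdd {s : Set E} (h₁ : BddAbove (f '' s)) (h₂ : BddBelow (f '' s)) :
    ∃ K, ∀ x ∈ s, |f x| ≤ K := by
  obtain ⟨M, hM⟩ := h₁
  obtain ⟨m, hm⟩ := h₂
  exact ⟨M ⊔ -m, fun x hx => abs_le'.2 ⟨(hM ⟨x, hx, rfl⟩).trans le_sup_left,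
    (neg_le_neg (hm ⟨x, hx, rfl⟩)).trans le_sup_right⟩⟩

omit [IsOrderedAddMonoid E] in
theorem abs_neg_le_of_forall_abs_le {s : Set E} (hK : ∀ x ∈ s, |f x| ≤ K) : ∀ x ∈ s, |-f x| ≤ K :=
  fun x hx => by rw [abs_neg]; exact hK x hx

variable [IsFAlgebra E]

theorem mul_le_upperSum {m : E} (hK : ∀ x ∈ Icc a b, |f x| ≤ K) (hm : ∀ x ∈ Icc a b, m ≤ f x)
    {n : ℕ} {x : ℕ → E} (hx : IsPartition a b n x) : m * (b - a) ≤ upperSum f n x := by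
  rw [← hx.1, ← hx.2.1, ← Finset.sum_range_sub, Finset.mul_sum]
  refine Finset.sum_le_sum fun i hi => ?_
  have hi' := Finset.mem_range.1 hi
  refine mul_le_mul_of_nonneg_right ?_ (sub_nonneg.2 (hx.2.2 i hi'))
  have hs : Icc (x i) (x (i + 1)) ⊆ Icc a b := Icc_subset_Icc (hx.mem hi'.le).1 (hx.mem hi').2
  exact (hm _ (hx.mem hi'.le)).trans (le_csSup
    ((bddAbove_image_of_abs_le hK).mono (image_mono hs))
    ⟨x i, left_mem_Icc.2 (hx.2.2 i hi'), rfl⟩)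

theorem upperIntegral_le_upperSum (hK : ∀ x ∈ Icc a b, |f x| ≤ K) {n : ℕ} {x : ℕ → E}
    (hx : IsPartition a b n x) : upperIntegral f a b ≤ upperSum f n x := by
  refine csInf_le ⟨-K * (b - a), ?_⟩ ⟨n, x, hx, rfl⟩
  rintro _ ⟨n, x, hx, rfl⟩
  exact mul_le_upperSum hK (fun x hx => neg_le.1 ((neg_le_abs _).trans (hK x hx))) hx

omit [IsOrderedAddMonoid E] [IsFAlgebra E] in
theorem le_upperIntegral (hab : a ≤ b) {t : E}
    (h : ∀ n x, IsPartition a b n x → t ≤ upperSum f n x) : t ≤ upperIntegral f a b := by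
  refine le_csInf ⟨_, 1, _, isPartition_trivial hab, rfl⟩ ?_
  rintro _ ⟨n, x, hx, rfl⟩
  exact h n x hx

theorem mul_le_upperIntegral (hab : a ≤ b) {m : E} (hK : ∀ x ∈ Icc a b, |f x| ≤ K)
    (hm : ∀ x ∈ Icc a b, m ≤ f x) : m * (b - a) ≤ upperIntegral f a b :=
  le_upperIntegral hab fun _ _ hx => mul_le_upperSum hK hm hx

theorem upperIntegral_le_mul (hab : a ≤ b) {M : E} (hK : ∀ x ∈ Icc a b, |f x| ≤ K)
    (hM : ∀ x ∈ Icc a b, f x ≤ M) : upperIntegral f a b ≤ M * (b - a) := by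
  refine (upperIntegral_le_upperSum hK (isPartition_trivial hab)).trans ?_
  simp only [upperSum, Finset.sum_range_one, if_true, zero_add, one_ne_zero, if_false]
  refine mul_le_mul_of_nonneg_right (csSup_le ⟨_, a, left_mem_Icc.2 hab, rfl⟩ ?_)
    (sub_nonneg.2 hab)
  rintro _ ⟨x, hx, rfl⟩
  exact hM x hx

theorem upperIntegral_le_add (hau : a ≤ u) (hub : u ≤ b) (hK : ∀ x ∈ Icc a b, |f x| ≤ K) :
    upperIntegral f a b ≤ upperIntegral f a u + upperIntegral f u b := by
  rw [← sub_le_iff_le_add']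
  refine le_upperIntegral hub fun m y hy => ?_
  rw [sub_le_comm]
  refine le_upperIntegral hau fun n x hx => ?_
  obtain ⟨z, hz, hsum⟩ := hx.append hy f
  rw [sub_le_iff_le_add, ← hsum]
  exact upperIntegral_le_upperSum hK hz

variable [Algebra ℝ E] [IsOrderedModule ℝ E]

/-- Comparison of suprema that are weighted by a positive element `l`: it suffices to compare the
values of `f` on the support of `l`. -/
theorem sSup_image_mul_le (hf : IdempotentLocalOn f (Icc a b)) (hK : ∀ x ∈ Icc a b, |f x| ≤ K)
    {s t : Set E} (hs : s ⊆ Icc a b) (hsn : s.Nonempty) (ht : t ⊆ Icc a b) {l : E} (hl : 0 ≤ l)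
    (h : ∀ q ∈ s, ∃ p ∈ t, (q - p) * l = 0) : sSup (f '' s) * l ≤ sSup (f '' t) * l := by
  have hB := bddAbove_image_of_abs_le hK
  refine mul_le_of_isLUB (isLUB_csSup (hsn.image f) (hB.mono (image_mono hs))) hl ?_
  rintro _ ⟨q, hq, rfl⟩
  obtain ⟨p, hp, hpq⟩ := h q hq
  rw [hf.mul_eq_mul (hs hq) (ht hp) hl hpq]
  exact mul_le_mul_of_nonneg_right (le_csSup (hB.mono (image_mono ht)) ⟨p, hp, rfl⟩) hl

omit [Algebra ℝ E] [IsOrderedModule ℝ E] in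
theorem posPart_sub_mul_posPart_sub (x y : E) : (x - y)⁺ * (y - x)⁺ = 0 := by
  rw [← neg_sub x y, posPart_neg]
  exact posPart_mul_negPart _

theorem add_le_upperIntegral (hau : a ≤ u) (hub : u ≤ b) (hf : IdempotentLocalOn f (Icc a b))
    (hK : ∀ x ∈ Icc a b, |f x| ≤ K) :
    upperIntegral f a u + upperIntegral f u b ≤ upperIntegral f a b := by
  refine le_upperIntegral (hau.trans hub) fun n x hx => ?_
  have h1 : IsPartition a u n (fun i => x i ⊓ u) :=
    ⟨by simp only [hx.1, inf_eq_left.2 hau], by simp only [hx.2.1, inf_eq_right.2 hub],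
      fun i hi => inf_le_inf_right u (hx.2.2 i hi)⟩
  have h2 : IsPartition u b n (fun i => x i ⊔ u) :=
    ⟨by simp only [hx.1, sup_eq_right.2 hau], by simp only [hx.2.1, sup_eq_left.2 hub],
      fun i hi => sup_le_sup_right (hx.2.2 i hi) u⟩
  refine (add_le_add
    (upperIntegral_le_upperSum (fun t ht => hK t ⟨ht.1, ht.2.trans hub⟩) h1)
    (upperIntegral_le_upperSum (fun t ht => hK t ⟨hau.trans ht.1, ht.2⟩) h2)).trans ?_
  unfold upperSum
  rw [← Finset.sum_add_distrib]
  refine Finset.sum_le_sum fun i hi => ?_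
  have hi' := Finset.mem_range.1 hi
  have hle := hx.2.2 i hi'
  have hxi := hx.mem hi'.le
  have hxj := hx.mem (show i + 1 ≤ n from hi')
  set p := x i
  set q := x (i + 1)
  have hpq : Icc p q ⊆ Icc a b := Icc_subset_Icc hxi.1 hxj.2
  have hl1 : 0 ≤ q ⊓ u - p ⊓ u := sub_nonneg.2 (inf_le_inf_right u hle)
  have hl2 : 0 ≤ q ⊔ u - p ⊔ u := sub_nonneg.2 (sup_le_sup_right hle u)
  have hs1 : Icc (p ⊓ u) (q ⊓ u) ⊆ Icc a b :=
    Icc_subset_Icc (le_inf hxi.1 hau) (inf_le_left.trans hxj.2)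
  have hs2 : Icc (p ⊔ u) (q ⊔ u) ⊆ Icc a b :=
    Icc_subset_Icc (hxi.1.trans le_sup_left) (sup_le hxj.2 hub)
  -- where `p ⊓ u < q ⊓ u` one has `p < u`, and there `[p ⊓ u, q ⊓ u] ⊆ [p, q]`
  have e1 : sSup (f '' Icc (p ⊓ u) (q ⊓ u)) * (q ⊓ u - p ⊓ u)
      ≤ sSup (f '' Icc p q) * (q ⊓ u - p ⊓ u) := by
    refine sSup_image_mul_le hf hK hs1 ⟨_, left_mem_Icc.2 (inf_le_inf_right u hle)⟩ hpq hl1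
      fun t ht => ⟨t ⊔ p, ⟨le_sup_right, sup_le (ht.2.trans inf_le_left) hle⟩, ?_⟩
    have h3 : 0 ≤ t ⊔ p - t := sub_nonneg.2 le_sup_left
    have h4 : t ⊔ p - t ≤ (p - u)⁺ := by
      rw [sub_le_iff_le_add']
      have hp : p ⊓ u + (p - u)⁺ = p := by rw [inf_eq_sub_posPart_sub, sub_add_cancel]
      refine sup_le (le_add_of_nonneg_right (posPart_nonneg _)) ?_
      exact (le_of_eq hp.symm).trans (add_le_add ht.1 le_rfl)
    have h5 : q ⊓ u - p ⊓ u ≤ (u - p)⁺ := by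
      rw [inf_comm p u, inf_eq_sub_posPart_sub u p, sub_sub_eq_add_sub, sub_le_iff_le_add']
      exact add_le_add inf_le_right le_rfl
    have := mul_eq_zero_of_le h3 h4 hl1 h5 (posPart_sub_mul_posPart_sub p u)
    linear_combination -this
  have e2 : sSup (f '' Icc (p ⊔ u) (q ⊔ u)) * (q ⊔ u - p ⊔ u)
      ≤ sSup (f '' Icc p q) * (q ⊔ u - p ⊔ u) := by
    refine sSup_image_mul_le hf hK hs2 ⟨_, left_mem_Icc.2 (sup_le_sup_right hle u)⟩ hpq hl2
      fun t ht => ⟨t ⊓ q, ⟨le_inf (le_sup_left.trans ht.1) hle, inf_le_right⟩, ?_⟩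
    have h3 : 0 ≤ t - t ⊓ q := sub_nonneg.2 inf_le_left
    have h4 : t - t ⊓ q ≤ (u - q)⁺ := by
      rw [inf_eq_sub_posPart_sub, sub_sub_cancel]
      refine sup_le ?_ (posPart_nonneg _)
      rw [sub_le_iff_le_add]
      refine ht.2.trans (sup_le (le_add_of_nonneg_left (posPart_nonneg _)) ?_)
      rw [← sub_le_iff_le_add]
      exact le_posPart _
    have h5 : q ⊔ u - p ⊔ u ≤ (q - u)⁺ := by
      refine (sub_le_sub_left le_sup_right _).trans ?_
      rw [sup_sub, sub_self, posPart_def]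
    have := mul_eq_zero_of_le h3 h4 hl2 h5 (posPart_sub_mul_posPart_sub u q)
    exact this
  have e3 : (q ⊓ u - p ⊓ u) + (q ⊔ u - p ⊔ u) = q - p := by
    have h3 := inf_add_sup q u
    have h4 := inf_add_sup p u
    linear_combination h3 - h4
  refine (add_le_add e1 e2).trans_eq ?_
  rw [← mul_add, e3]

theorem upperIntegral_add (hau : a ≤ u) (hub : u ≤ b) (hf : IdempotentLocalOn f (Icc a b))
    (hK : ∀ x ∈ Icc a b, |f x| ≤ K) :
    upperIntegral f a u + upperIntegral f u b = upperIntegral f a b :=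
  le_antisymm (add_le_upperIntegral hau hub hf hK) (upperIntegral_le_add hau hub hK)

omit [Algebra ℝ E] [IsOrderedModule ℝ E] in
theorem lowerIntegral_eq_neg (hab : a ≤ b) (hK : ∀ x ∈ Icc a b, |f x| ≤ K) :
    lowerIntegral f a b = -upperIntegral (fun x => -f x) a b := by
  have hset : {s : E | ∃ (n : ℕ) (x : ℕ → E), IsPartition a b n x ∧ s = lowerSum f n x}
      = -{s : E | ∃ (n : ℕ) (x : ℕ → E), IsPartition a b n x ∧
        s = upperSum (fun x => -f x) n x} := by
    ext s
    simp only [mem_ofPred_eq, Set.mem_neg]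
    refine exists_congr fun n => exists_congr fun x => and_congr_right fun hx => ?_
    have : upperSum (fun x => -f x) n x = -lowerSum f n x := by
      unfold upperSum lowerSum
      rw [← Finset.sum_neg_distrib]
      refine Finset.sum_congr rfl fun i hi => ?_
      have hi' := Finset.mem_range.1 hi
      have hs : Icc (x i) (x (i + 1)) ⊆ Icc a b :=
        Icc_subset_Icc (hx.mem hi'.le).1 (hx.mem hi').2
      have h1 : (fun x => -f x) '' Icc (x i) (x (i + 1)) = -(f '' Icc (x i) (x (i + 1))) := by
        rw [← image_neg_eq_neg, image_image]
      rw [h1, csSup_neg ((nonempty_Icc.2 (hx.2.2 i hi')).image f)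
        ((bddBelow_image_of_abs_le hK).mono (image_mono hs)), neg_mul]
    rw [this, neg_inj]
  unfold lowerIntegral upperIntegral
  rw [hset]
  refine csSup_neg ⟨_, 1, _, isPartition_trivial hab, rfl⟩ ⟨-K * (b - a), ?_⟩
  · rintro _ ⟨n, x, hx, rfl⟩
    exact mul_le_upperSum (abs_neg_le_of_forall_abs_le hK)
      (fun x hx => neg_le_neg ((le_abs_self _).trans (hK x hx))) hx

omit [Algebra ℝ E] [IsOrderedModule ℝ E] in
theorem integrableOnIcc_iff (hab : a ≤ b) (hK : ∀ x ∈ Icc a b, |f x| ≤ K) :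
    IntegrableOnIcc f a b ↔ upperIntegral f a b + upperIntegral (fun x => -f x) a b = 0 := by
  unfold IntegrableOnIcc
  rw [lowerIntegral_eq_neg hab hK, ← add_eq_zero_iff_eq_neg]
  exact ⟨fun h => h.2.2, fun h => ⟨bddAbove_image_of_abs_le hK, bddBelow_image_of_abs_le hK, h⟩⟩

omit [ConditionallyCompleteLattice E] [IsOrderedAddMonoid E] [IsFAlgebra E] [Algebra ℝ E]
  [IsOrderedModule ℝ E] in
theorem IdempotentLocalOn.mono {s t : Set E} (hf : IdempotentLocalOn f s) (h : t ⊆ s) :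
    IdempotentLocalOn f t :=
  fun e he x hx y hy => hf e he x (h hx) y (h hy)

omit [ConditionallyCompleteLattice E] [IsOrderedAddMonoid E] [IsFAlgebra E] [Algebra ℝ E]
  [IsOrderedModule ℝ E] in
theorem IdempotentLocalOn.neg {s : Set E} (hf : IdempotentLocalOn f s) :
    IdempotentLocalOn (fun x => -f x) s :=
  fun e he x hx y hy h => by rw [mul_neg, mul_neg, hf e he x hx y hy h]

/-- The lower integral is at most the upper integral. Two chains of partition points have no common
refinement that is a chain, so this rests on the additivity of the upper integral. -/
theorem upperIntegral_add_upperIntegral_neg_nonneg (hab : a ≤ b)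
    (hf : IdempotentLocalOn f (Icc a b)) (hK : ∀ x ∈ Icc a b, |f x| ≤ K) :
    0 ≤ upperIntegral f a b + upperIntegral (fun x => -f x) a b := by
  rw [← neg_le_iff_add_nonneg']
  refine le_upperIntegral hab fun n x hx => ?_
  have key : ∀ i ≤ n, -upperIntegral f a (x i) ≤ upperSum (fun x => -f x) i x := by
    intro i
    induction i with
    | zero =>
      intro _
      rw [hx.1]
      have hm : ∀ t ∈ Icc a a, |f t| ≤ K := fun t ht => hK t ⟨ht.1, ht.2.trans hab⟩
      have := mul_le_upperIntegral le_rfl hm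
        (fun t ht => neg_le.1 ((neg_le_abs _).trans (hm t ht)))
      rw [sub_self, mul_zero] at this
      simpa [upperSum] using this
    | succ i ih =>
      intro hi
      have hxi := hx.mem (Nat.le_of_succ_le hi)
      have hxj := hx.mem hi
      have hle := hx.2.2 i hi
      have hs : Icc (x i) (x (i + 1)) ⊆ Icc a b := Icc_subset_Icc hxi.1 hxj.2
      have h1 := upperIntegral_add hxi.1 hle (hf.mono (Icc_subset_Icc_right hxj.2))
        (fun t ht => hK t ⟨ht.1, ht.2.trans hxj.2⟩)
      have hb : BddAbove ((fun x => -f x) '' Icc (x i) (x (i + 1))) :=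
        bddAbove_image_of_abs_le fun t ht => abs_neg_le_of_forall_abs_le hK t (hs ht)
      have h2 := mul_le_upperIntegral (m := -sSup ((fun x => -f x) '' Icc (x i) (x (i + 1))))
        hle (fun t ht => hK t (hs ht)) (fun t ht => neg_le.1 (le_csSup hb ⟨t, ht, rfl⟩))
      have h3 : upperSum (fun x => -f x) (i + 1) x = upperSum (fun x => -f x) i x
          + sSup ((fun x => -f x) '' Icc (x i) (x (i + 1))) * (x (i + 1) - x i) :=
        Finset.sum_range_succ _ _
      rw [h3]
      linear_combination ih (Nat.le_of_succ_le hi) + h2 + h1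
  have := key n le_rfl
  rwa [hx.2.1] at this

theorem IntegrableOnIcc.mono {v : E} (h : IntegrableOnIcc f c d)
    (hf : IdempotentLocalOn f (Icc c d)) (hcu : c ≤ u) (huv : u ≤ v) (hvd : v ≤ d) :
    IntegrableOnIcc f u v := by
  obtain ⟨K, hK⟩ := exists_abs_le_of_bdd h.1 h.2.1
  have hud := huv.trans hvd
  have hKu : ∀ x ∈ Icc u d, |f x| ≤ K := fun x hx => hK x ⟨hcu.trans hx.1, hx.2⟩
  have hfu := hf.mono (Icc_subset_Icc_left hcu : Icc u d ⊆ Icc c d)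
  have hs1 : Icc c u ⊆ Icc c d := Icc_subset_Icc_right hud
  have hs2 : Icc v d ⊆ Icc c d := Icc_subset_Icc_left (hcu.trans huv)
  have hs3 : Icc u v ⊆ Icc c d := Icc_subset_Icc hcu hvd
  have e := (integrableOnIcc_iff (hcu.trans hud) hK).1 h
  have e1 := upperIntegral_add hcu hud hf hK
  have e2 := upperIntegral_add huv hvd hfu hKu
  have e3 := upperIntegral_add hcu hud hf.neg (abs_neg_le_of_forall_abs_le hK)
  have e4 := upperIntegral_add huv hvd hfu.neg (abs_neg_le_of_forall_abs_le hKu)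
  have g1 := upperIntegral_add_upperIntegral_neg_nonneg hcu (hf.mono hs1) (fun x hx => hK x (hs1 hx))
  have g2 := upperIntegral_add_upperIntegral_neg_nonneg hvd (hf.mono hs2) (fun x hx => hK x (hs2 hx))
  have g3 := upperIntegral_add_upperIntegral_neg_nonneg huv (hf.mono hs3) (fun x hx => hK x (hs3 hx))
  rw [integrableOnIcc_iff huv (fun x hx => hK x (hs3 hx))]
  refine le_antisymm ?_ g3
  linear_combination g1 + g2 + e + e1 + e2 + e3 + e4

/-! ### Indefinite integrals -/

theorem abs_upperIntegral_sub_le {A w p q : E} (hf : IdempotentLocalOn f (Icc c d))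
    (hK : ∀ x ∈ Icc c d, |f x| ≤ K) (hp : p ∈ Icc c d) (hq : q ∈ Icc c d)
    (h : ∀ v ∈ Icc c d, |v - q| ≤ |p - q| → |f v - A| ≤ w) :
    |upperIntegral f c p - upperIntegral f c q - (p - q) * A| ≤ |p - q| * w := by
  have hr : p ⊓ q ∈ Icc c d := ⟨le_inf hp.1 hq.1, inf_le_left.trans hp.2⟩
  have key : ∀ t ∈ Icc c d, p ⊓ q ≤ t → (∀ v ∈ Icc (p ⊓ q) t, |v - q| ≤ |p - q|) →
      (A - w) * (t - p ⊓ q) ≤ upperIntegral f c t - upperIntegral f c (p ⊓ q) ∧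
      upperIntegral f c t - upperIntegral f c (p ⊓ q) ≤ (A + w) * (t - p ⊓ q) := by
    intro t ht hrt hv
    have hs : Icc (p ⊓ q) t ⊆ Icc c d := Icc_subset_Icc hr.1 ht.2
    have e := upperIntegral_add hr.1 hrt (hf.mono (Icc_subset_Icc_right ht.2))
      (fun x hx => hK x ⟨hx.1, hx.2.trans ht.2⟩)
    rw [← e, add_sub_cancel_left]
    refine ⟨mul_le_upperIntegral hrt (fun x hx => hK x (hs hx)) fun x hx => ?_,
      upperIntegral_le_mul hrt (fun x hx => hK x (hs hx)) fun x hx => ?_⟩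
    · have := (neg_le_abs _).trans (h x (hs hx) (hv x hx))
      linear_combination this
    · have := (le_abs_self _).trans (h x (hs hx) (hv x hx))
      linear_combination this
  have hqr : q - p ⊓ q ≤ |p - q| := by
    rw [inf_comm, inf_eq_sub_posPart_sub, sub_sub_cancel, abs_sub_comm]
    exact sup_le (le_abs_self _) (abs_nonneg _)
  have hlow : ∀ v, p ⊓ q ≤ v → -(v - q) ≤ |p - q| := fun v hv => by
    linear_combination hv + hqr
  obtain ⟨h1, h2⟩ := key p hp inf_le_left fun v hv => abs_le'.2
    ⟨(sub_le_sub_right hv.2 q).trans (le_abs_self _), hlow v hv.1⟩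
  obtain ⟨h3, h4⟩ := key q hq inf_le_right fun v hv => abs_le'.2
    ⟨(sub_nonpos.2 hv.2).trans (abs_nonneg _), hlow v hv.1⟩
  have habs : |p - q| = p + q - (p ⊓ q + p ⊓ q) := by
    have e1 := sup_sub_inf_eq_abs_sub q p
    have e2 := inf_add_sup p q
    rw [inf_comm q, sup_comm q] at e1
    rw [← e1, ← e2]
    abel
  rw [habs]
  refine abs_le'.2 ⟨?_, ?_⟩
  · linear_combination h2 + h3
  · linear_combination h1 + h4

/-- The indefinite integral of a function bounded by `K` is Lipschitz with constant `K`. -/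
theorem abs_upperIntegral_sub_le_mul {p q : E} (hf : IdempotentLocalOn f (Icc c d))
    (hK : ∀ x ∈ Icc c d, |f x| ≤ K) (hp : p ∈ Icc c d) (hq : q ∈ Icc c d) :
    |upperIntegral f c p - upperIntegral f c q| ≤ |p - q| * K := by
  have := abs_upperIntegral_sub_le (A := 0) hf hK hp hq fun v hv _ => by
    rw [sub_zero]
    exact hK v hv
  rwa [mul_zero, sub_zero] at this

theorem idempotentLocalOn_upperIntegral (hf : IdempotentLocalOn f (Icc c d))
    (hK : ∀ x ∈ Icc c d, |f x| ≤ K) :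
    IdempotentLocalOn (fun p => upperIntegral f c p) (Icc c d) := by
  intro e he p hp q hq hpq
  rw [← sub_eq_zero, ← mul_sub]
  refine eq_zero_of_abs_eq_zero (le_antisymm ?_ (abs_nonneg _))
  have he0 := idempotent_nonneg he
  rw [abs_mul_of_nonneg he0]
  refine (mul_le_mul_of_nonneg_left (abs_upperIntegral_sub_le_mul hf hK hp hq) he0).trans_eq ?_
  rw [← mul_assoc, ← abs_mul_of_nonneg he0, mul_sub, hpq, sub_self, abs_zero, zero_mul]

/-- The integral between arbitrary endpoints is the increment of the indefinite integral. -/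
theorem integral_eq_sub {p q : E} (hf : IdempotentLocalOn f (Icc c d))
    (hK : ∀ x ∈ Icc c d, |f x| ≤ K) (hp : p ∈ Icc c d) (hq : q ∈ Icc c d) :
    integral f p q = upperIntegral f c q - upperIntegral f c p := by
  have hi : p ⊓ q ∈ Icc c d := ⟨le_inf hp.1 hq.1, inf_le_left.trans hp.2⟩
  have hs : p ⊔ q ∈ Icc c d := ⟨hp.1.trans le_sup_left, sup_le hp.2 hq.2⟩
  have hI : upperIntegral f (p ⊓ q) (p ⊔ q)
      = upperIntegral f c (p ⊔ q) - upperIntegral f c (p ⊓ q) :=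
    eq_sub_of_add_eq' (upperIntegral_add hi.1 inf_le_sup (hf.mono (Icc_subset_Icc_right hs.2))
      (fun x hx => hK x ⟨hx.1, hx.2.trans hs.2⟩))
  -- a multiplier that annihilates `x - y` annihilates the increment between `y` and `x`
  have hkill : ∀ k x y : E, x ∈ Icc c d → y ∈ Icc c d → k * (x - y) = 0 →
      k * (upperIntegral f c x - upperIntegral f c y) = 0 := fun k x y hx hy h => by
    refine eq_zero_of_abs_eq_zero (le_antisymm ?_ (abs_nonneg _))
    refine (abs_mul_le _ _).trans ((mul_le_mul_of_nonneg_left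
      (abs_upperIntegral_sub_le_mul hf hK hx hy) (abs_nonneg k)).trans_eq ?_)
    rw [← mul_assoc, abs_mul_abs_eq_zero h, zero_mul]
  obtain ⟨e₁, he₁, h1, h1'⟩ := exists_bandProj_bandLT p q
  obtain ⟨e₂, he₂, h2, h2'⟩ := exists_bandProj_bandLT q p
  unfold integral
  rw [h1', h2', hI]
  have hpos := posPart_sub_negPart (q - p)
  have hneg : (p - q)⁺ = (q - p)⁻ := by rw [← posPart_neg, neg_sub]
  have z1 : e₁ * (p - q)⁺ = 0 := by
    rw [← posPart_mul_of_nonneg he₁, ← neg_sub q p, mul_neg, h1]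
    exact posPart_of_nonpos (neg_nonpos.2 (posPart_nonneg _))
  have z2 : e₂ * (q - p)⁺ = 0 := by
    rw [← posPart_mul_of_nonneg he₂, ← neg_sub p q, mul_neg, h2]
    exact posPart_of_nonpos (neg_nonpos.2 (posPart_nonneg _))
  have hsup : p ⊔ q = q + (p - q)⁺ := sup_eq_add_posPart_sub p q
  have hinf : p ⊓ q = p - (p - q)⁺ := inf_eq_sub_posPart_sub p q
  have k1 := hkill e₁ (p ⊔ q) q hs hq (by rw [hsup]; linear_combination z1)
  have k2 := hkill e₁ (p ⊓ q) p hi hp (by rw [hinf]; linear_combination -z1)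
  have k3 := hkill e₂ (p ⊔ q) p hs hp (by rw [hsup]; linear_combination z2 + e₂ * hneg - e₂ * hpos)
  have k4 := hkill e₂ (p ⊓ q) q hi hq (by
    rw [hinf]; linear_combination -z2 - e₂ * hneg + e₂ * hpos)
  have k5 := hkill (1 - e₁ - e₂) q p hq hp (by
    linear_combination -h1 - hpos + h2 + hneg)
  linear_combination k1 - k2 - k3 + k4 - k5

end Darboux

/-! ### Dyadic scales -/

section Dyadic

variable {E : Type u} [CommRing E] [ConditionallyCompleteLattice E] [IsOrderedAddMonoid E]
  [IsFAlgebra E]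

theorem two_pow_nonneg (n : ℕ) : (0 : E) ≤ 2 ^ n := by
  have h : (2 : E) ^ n = ((2 ^ n : ℕ) : E) := by push_cast; rfl
  rw [h]
  exact Nat.cast_nonneg _

theorem two_pow_mul_le_two_pow_mul {n k : ℕ} (h : n ≤ k) {x : E} (hx : 0 ≤ x) :
    2 ^ n * x ≤ 2 ^ k * x := by
  have h1 : ((2 ^ n : ℕ) : E) ≤ ((2 ^ k : ℕ) : E) :=
    Nat.mono_cast (Nat.pow_le_pow_right (by norm_num) h)
  have := mul_le_mul_of_nonneg_right h1 hx
  simpa using this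

/-- The Archimedean property along powers of `2`. -/
theorem nonpos_of_two_pow_mul_le {x z : E} (hz : 0 ≤ z) (N : ℕ)
    (h : ∀ n, N ≤ n → 2 ^ n * x ≤ z) : x ≤ 0 := by
  refine (le_posPart x).trans (nonpos_of_forall_nsmul_le (y := z) fun n => ?_)
  have h1 : 2 ^ (N + n) * x⁺ ≤ z := by
    rw [← posPart_mul_of_nonneg (two_pow_nonneg _)]
    exact sup_le (h _ (Nat.le_add_right _ _)) hz
  refine le_trans ?_ h1
  have h2 : ((n : ℕ) : E) ≤ ((2 ^ (N + n) : ℕ) : E) :=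
    Nat.mono_cast (Nat.lt_two_pow_self.le.trans
      (Nat.pow_le_pow_right (by norm_num) (Nat.le_add_left n N)))
  have := mul_le_mul_of_nonneg_right h2 (posPart_nonneg x)
  rw [nsmul_eq_mul]
  simpa using this

variable [Algebra ℝ E]

omit [ConditionallyCompleteLattice E] [IsOrderedAddMonoid E] [IsFAlgebra E] in
theorem two_pow_mul_smul (n : ℕ) (z : E) : 2 ^ n * (((1 / 2 : ℝ) ^ n) • z) = z := by
  have h : (2 : E) ^ n = algebraMap ℝ E (2 ^ n) := by rw [map_pow, map_ofNat]
  rw [h, ← Algebra.smul_def, smul_smul, ← mul_pow]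
  norm_num

omit [ConditionallyCompleteLattice E] [IsOrderedAddMonoid E] [IsFAlgebra E] in
theorem smul_two_pow_mul (n : ℕ) (z : E) : ((1 / 2 : ℝ) ^ n) • (2 ^ n * z) = z := by
  rw [← mul_smul_comm, two_pow_mul_smul]

omit [ConditionallyCompleteLattice E] [IsOrderedAddMonoid E] [IsFAlgebra E] in
theorem eq_zero_of_two_pow_mul {n : ℕ} {x : E} (h : 2 ^ n * x = 0) : x = 0 := by
  rw [← smul_two_pow_mul n x, h, smul_zero]

variable [IsOrderedModule ℝ E]

omit [IsOrderedAddMonoid E] [IsFAlgebra E] in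
theorem le_of_two_pow_mul_le {n : ℕ} {x y : E} (h : 2 ^ n * x ≤ 2 ^ n * y) : x ≤ y := by
  have := smul_le_smul_of_nonneg_left h (by positivity : (0 : ℝ) ≤ (1 / 2) ^ n)
  rwa [smul_two_pow_mul, smul_two_pow_mul] at this

omit [IsOrderedModule ℝ E] in
theorem two_pow_mul_le_of_le_smul {n : ℕ} {x z : E} (h : x ≤ ((1 / 2 : ℝ) ^ n) • z) :
    2 ^ n * x ≤ z := by
  have := mul_le_mul_of_nonneg_left h (two_pow_nonneg (E := E) n)
  rwa [two_pow_mul_smul] at this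

omit [IsOrderedAddMonoid E] [IsFAlgebra E] in
theorem le_smul_of_two_pow_mul_le {n : ℕ} {x z : E} (h : 2 ^ n * x ≤ z) :
    x ≤ ((1 / 2 : ℝ) ^ n) • z := by
  refine le_of_two_pow_mul_le (n := n) ?_
  rwa [two_pow_mul_smul]

theorem decreasesToZero_dyadic {z : E} (hz : 0 ≤ z) :
    DecreasesToZero (range fun n : ℕ => ((1 / 2 : ℝ) ^ n) • z) := by
  refine ⟨range_nonempty _, ?_, ?_, fun l hl => ?_⟩
  · rintro _ ⟨n, rfl⟩ _ ⟨m, rfl⟩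
    have key : ∀ i j : ℕ, i ≤ j → ((1 / 2 : ℝ) ^ j) • z ≤ ((1 / 2 : ℝ) ^ i) • z := fun i j hij =>
      smul_le_smul_of_nonneg_right
        (pow_le_pow_of_le_one (by norm_num) (by norm_num) hij) hz
    exact ⟨_, ⟨max n m, rfl⟩, key _ _ (le_max_left _ _), key _ _ (le_max_right _ _)⟩
  · rintro _ ⟨n, rfl⟩
    exact smul_nonneg (by positivity) hz
  · exact nonpos_of_two_pow_mul_le hz 0 fun n _ => two_pow_mul_le_of_le_smul (hl ⟨n, rfl⟩)

/-! ### Continuity and differentiability along dyadic scales -/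

/-- Order continuity of `f` at `c` within `s`, tested on the scales `2⁻ⁿ z`. -/
def DyadicContinuousWithinAt (f : E → E) (s : Set E) (c : E) : Prop :=
  ∀ z : E, 0 ≤ z → ∃ A : Set E, IsGLB A 0 ∧ ∀ ε ∈ A, ∃ n : ℕ, ∀ v ∈ s,
    2 ^ n * |v - c| ≤ z → |f v - f c| ≤ ε

/-- The index set of a net that runs through all points of `α` satisfying `P · n`, ordered by `n`
alone. -/
structure ScaleNet {α : Type u} (P : α → ℕ → Prop) : Type u where
  point : α
  scale : ℕ
  prop : P point scale

instance {α : Type u} (P : α → ℕ → Prop) : Preorder (ScaleNet P) := Preorder.lift ScaleNet.scale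

theorem ScaleNet.isDirected {α : Type u} {P : α → ℕ → Prop} {c : α} (h : ∀ n, P c n) :
    IsDirected (ScaleNet P) (· ≤ ·) :=
  ⟨fun p q => ⟨⟨c, max p.scale q.scale, h _⟩, le_max_left p.scale q.scale,
    le_max_right p.scale q.scale⟩⟩

theorem OrderContinuousOn.dyadicContinuousWithinAt {f : E → E} {s : Set E}
    (hf : OrderContinuousOn f s) {c : E} (hc : c ∈ s) : DyadicContinuousWithinAt f s c := by
  intro z hz
  let P : E → ℕ → Prop := fun v n => v ∈ s ∧ 2 ^ n * |v - c| ≤ z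
  have hcm : ∀ n : ℕ, P c n := fun n => by
    refine ⟨hc, ?_⟩
    rw [sub_self, abs_zero, mul_zero]
    exact hz
  have : Nonempty (ScaleNet P) := ⟨⟨c, 0, hcm 0⟩⟩
  have := ScaleNet.isDirected hcm
  obtain ⟨A, hA, h⟩ := hf c hc (ScaleNet P) ScaleNet.point (fun p => p.prop.1)
    ⟨_, (decreasesToZero_dyadic hz).2.2, by
      rintro _ ⟨n, rfl⟩
      refine ⟨⟨c, n, hcm n⟩, fun p hp => le_smul_of_two_pow_mul_le ?_⟩
      exact (two_pow_mul_le_two_pow_mul hp (abs_nonneg _)).trans p.prop.2⟩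
  refine ⟨A, hA, fun ε hε => ?_⟩
  obtain ⟨p, hp⟩ := h ε hε
  exact ⟨p.scale, fun v hv hvz => hp ⟨v, p.scale, hv, hvz⟩ (le_refl p.scale)⟩

theorem UniformlyOrderContinuousOn.exists_modulus {f : E → E} {s : Set E}
    (hf : UniformlyOrderContinuousOn f s) (hs : s.Nonempty) {z : E} (hz : 0 ≤ z) :
    ∃ A : Set E, IsGLB A 0 ∧ ∀ ε ∈ A, ∃ n : ℕ, ∀ x ∈ s, ∀ y ∈ s,
      2 ^ n * |x - y| ≤ z → |f x - f y| ≤ ε := by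
  obtain ⟨c, hc⟩ := hs
  let P : E × E → ℕ → Prop := fun v n => v.1 ∈ s ∧ v.2 ∈ s ∧ 2 ^ n * |v.1 - v.2| ≤ z
  have hcm : ∀ n : ℕ, P (c, c) n := fun n => by
    refine ⟨hc, hc, ?_⟩
    rw [sub_self, abs_zero, mul_zero]
    exact hz
  have : Nonempty (ScaleNet P) := ⟨⟨(c, c), 0, hcm 0⟩⟩
  have := ScaleNet.isDirected hcm
  obtain ⟨A, hA, h⟩ := hf (ScaleNet P) (fun p => p.point.1) (fun p => p.point.2)
    (fun p => p.prop.1) (fun p => p.prop.2.1) ⟨_, (decreasesToZero_dyadic hz).2.2, by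
      rintro _ ⟨n, rfl⟩
      refine ⟨⟨(c, c), n, hcm n⟩, fun p hp => le_smul_of_two_pow_mul_le ?_⟩
      rw [sub_zero]
      exact (two_pow_mul_le_two_pow_mul hp (abs_nonneg _)).trans p.prop.2.2⟩
  refine ⟨A, hA, fun ε hε => ?_⟩
  obtain ⟨p, hp⟩ := h ε hε
  refine ⟨p.scale, fun x hx y hy hxy => ?_⟩
  have := hp ⟨(x, y), p.scale, hx, hy, hxy⟩ (le_refl p.scale)
  rwa [sub_zero] at this

/-- Order differentiability of `H` at `p` within `s`, tested on the scales `2⁻ⁿ z` and for points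
with `|x - p| ≤ r`, where `r` is a weak order unit. -/
def HasDyadicDerivWithinAt (H : E → E) (s : Set E) (h p : E) : Prop :=
  ∃ r : E, 0 ≤ r ∧ (∀ u, u * r = 0 → u = 0) ∧ ∀ z : E, 0 ≤ z →
    ∃ A : Set E, IsGLB A 0 ∧ ∀ ε ∈ A, ∃ n : ℕ, ∀ x ∈ s, |x - p| ≤ r → 2 ^ n * |x - p| ≤ z →
      |H x - H p - (x - p) * h| ≤ |x - p| * ε

omit [Algebra ℝ E] [IsOrderedModule ℝ E] in
theorem weakUnit_of_le {r t : E} (hr : 0 ≤ r) (h : ∀ u, u * r = 0 → u = 0) (hrt : r ≤ t) (u : E)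
    (hu : u * t = 0) : u = 0 :=
  h u (mul_eq_zero_of_abs_mul hr (mul_eq_zero_of_le (abs_nonneg u) le_rfl hr hrt
    (abs_mul_eq_zero (hr.trans hrt) hu)))

theorem HasOrderDerivAt.hasDyadicDerivWithinAt {G : E → E} {s : Set E} {g p : E}
    (hG : HasOrderDerivAt s G g p) : HasDyadicDerivWithinAt G s g p := by
  obtain ⟨r, hr, -, h⟩ := hG
  rw [weakUnitLT_iff, sub_zero] at hr
  have e : 2 * ((1 / 2 : ℝ) • r) = r := by simpa using two_pow_mul_smul 1 r
  have hr2 : 0 ≤ (1 / 2 : ℝ) • r := smul_nonneg (by norm_num) hr.1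
  have hu : ∀ u, u * ((1 / 2 : ℝ) • r) = 0 → u = 0 := fun u hu =>
    hr.2 u (by linear_combination 2 * hu - u * e)
  refine ⟨(1 / 2 : ℝ) • r, hr2, hu, fun z hz => ?_⟩
  obtain ⟨A, hA, h⟩ := h _ (decreasesToZero_dyadic hz)
  refine ⟨A, hA, fun ε hε => ?_⟩
  obtain ⟨_, ⟨n, rfl⟩, hn⟩ := h ε hε
  refine ⟨n, fun x _ hxr hxn => hn x ?_ (le_smul_of_two_pow_mul_le hxn)⟩
  have h1 : (1 / 2 : ℝ) • r ≤ x - (p - r) := by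
    linear_combination (neg_le_abs (x - p)).trans hxr + e
  have h2 : (1 / 2 : ℝ) • r ≤ p + r - x := by
    linear_combination (le_abs_self (x - p)).trans hxr + e
  exact ⟨weakUnitLT_iff.2 ⟨sub_nonneg.1 (hr2.trans h1), weakUnit_of_le hr2 hu h1⟩,
    weakUnitLT_iff.2 ⟨sub_nonneg.1 (hr2.trans h2), weakUnit_of_le hr2 hu h2⟩⟩

omit [IsOrderedAddMonoid E] [IsFAlgebra E] [Algebra ℝ E] [IsOrderedModule ℝ E] in
theorem HasDyadicDerivWithinAt.neg {H : E → E} {s : Set E} {h p : E}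
    (hH : HasDyadicDerivWithinAt H s h p) :
    HasDyadicDerivWithinAt (fun x => -H x) s (-h) p := by
  obtain ⟨r, hr, hu, hd⟩ := hH
  refine ⟨r, hr, hu, fun z hz => ?_⟩
  obtain ⟨A, hA, hd⟩ := hd z hz
  refine ⟨A, hA, fun ε hε => ?_⟩
  obtain ⟨n, hn⟩ := hd ε hε
  refine ⟨n, fun x hx h1 h2 => ?_⟩
  rw [← abs_neg]
  convert hn x hx h1 h2 using 2
  ring

omit [IsOrderedAddMonoid E] [IsFAlgebra E] [Algebra ℝ E] [IsOrderedModule ℝ E] in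
theorem DyadicContinuousWithinAt.neg {f : E → E} {s : Set E} {c : E}
    (hf : DyadicContinuousWithinAt f s c) : DyadicContinuousWithinAt (fun x => -f x) s c := by
  intro z hz
  obtain ⟨A, hA, h⟩ := hf z hz
  refine ⟨A, hA, fun ε hε => ?_⟩
  obtain ⟨n, hn⟩ := h ε hε
  refine ⟨n, fun v hv hvz => ?_⟩
  rw [← neg_sub', abs_neg]
  exact hn v hv hvz

/-! ### The mean value inequality -/

omit [Algebra ℝ E] [IsOrderedModule ℝ E] in
theorem idempotent_mix_mem_Icc {a b x y e : E} (he : e * e = e) (hx : x ∈ Icc a b)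
    (hy : y ∈ Icc a b) : e * x + (1 - e) * y ∈ Icc a b := by
  have h0 := idempotent_nonneg he
  have h1 := idempotent_nonneg (idempotent_compl he)
  constructor
  · linear_combination e * hx.1 + (1 - e) * hy.1
  · linear_combination e * hx.2 + (1 - e) * hy.2

omit [ConditionallyCompleteLattice E] [IsOrderedAddMonoid E] [IsFAlgebra E] [Algebra ℝ E]
  [IsOrderedModule ℝ E] in
/-- Local functions can be evaluated piecewise. -/
theorem IdempotentLocalOn.map_mix {f : E → E} {s : Set E} (hf : IdempotentLocalOn f s)
    {e x y : E} (he : e * e = e) (hx : x ∈ s) (hy : y ∈ s) (hw : e * x + (1 - e) * y ∈ s) :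
    f (e * x + (1 - e) * y) = e * f x + (1 - e) * f y := by
  have h1 := hf e he _ hw x hx (by linear_combination (x - y) * he)
  have h2 := hf (1 - e) (by linear_combination he) _ hw y hy (by linear_combination (y - x) * he)
  linear_combination h1 + h2

theorem exists_half_increment {H : E → E} {x y : E} (hxy : x ≤ y)
    (hH : IdempotentLocalOn H (Icc x y)) :
    ∃ x' y', x ≤ x' ∧ x' ≤ y' ∧ y' ≤ y ∧ 2 * (y' - x') = y - x ∧
      H y - H x ≤ 2 * (H y' - H x') := by
  have hm : 2 * ((1 / 2 : ℝ) • (y - x)) = y - x := by simpa using two_pow_mul_smul 1 (y - x)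
  have hm0 : 0 ≤ (1 / 2 : ℝ) • (y - x) := smul_nonneg (by norm_num) (sub_nonneg.2 hxy)
  set δ := (1 / 2 : ℝ) • (y - x)
  have hxm : x + δ ∈ Icc x y := ⟨le_add_of_nonneg_right hm0, by linear_combination hm0 + hm⟩
  obtain ⟨e, he, h1, h2⟩ := exists_idempotent_le (H (x + δ) - H x) (H y - H (x + δ))
  have he1 := idempotent_nonneg (idempotent_compl he)
  have he0 := idempotent_nonneg he
  have hx' := idempotent_mix_mem_Icc he hxm (left_mem_Icc.2 hxy)
  have hy' := idempotent_mix_mem_Icc he (right_mem_Icc.2 hxy) hxm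
  refine ⟨_, _, hx'.1, ?_, hy'.2, ?_, ?_⟩
  · linear_combination e * hxm.2 + (1 - e) * hxm.1
  · linear_combination (1 - 2 * e) * hm
  · rw [hH.map_mix he hxm (left_mem_Icc.2 hxy) hx', hH.map_mix he (right_mem_Icc.2 hxy) hxm hy']
    linear_combination h1 + h2

/-- Bisection: nested intervals of length `2⁻ⁿ (y - x)` around a point `p` on which the increment
of `H` is at least `2⁻ⁿ (H y - H x)`. On different bands different halves may have to be chosen;
locality of `H` allows gluing the choices. -/
theorem exists_nested_increments {H : E → E} {x y : E} (hxy : x ≤ y)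
    (hH : IdempotentLocalOn H (Icc x y)) :
    ∃ p ∈ Icc x y, ∀ n : ℕ, ∃ x' y', x ≤ x' ∧ x' ≤ p ∧ p ≤ y' ∧ y' ≤ y ∧
      2 ^ n * (y' - x') = y - x ∧ H y - H x ≤ 2 ^ n * (H y' - H x') := by
  let T : Type u := {q : E × E // x ≤ q.1 ∧ q.1 ≤ q.2 ∧ q.2 ≤ y}
  have step : ∀ q : T, ∃ q' : T, q.1.1 ≤ q'.1.1 ∧ q'.1.2 ≤ q.1.2 ∧
      2 * (q'.1.2 - q'.1.1) = q.1.2 - q.1.1 ∧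
      H q.1.2 - H q.1.1 ≤ 2 * (H q'.1.2 - H q'.1.1) := by
    rintro ⟨⟨s, t⟩, h1, h2, h3⟩
    obtain ⟨s', t', i1, i2, i3, i4, i5⟩ :=
      exists_half_increment h2 (hH.mono (Icc_subset_Icc h1 h3))
    exact ⟨⟨(s', t'), h1.trans i1, i2, i3.trans h3⟩, i1, i3, i4, i5⟩
  choose next hn1 hn2 hn3 hn4 using step
  let q : ℕ → T := fun n => next^[n] ⟨(x, y), le_rfl, hxy, le_rfl⟩
  have hq : ∀ n, q (n + 1) = next (q n) := fun n => Function.iterate_succ_apply' _ _ _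
  have hmono : Monotone fun n => (q n).1.1 := monotone_nat_of_le_succ fun n => by
    rw [hq]
    exact hn1 _
  have hanti : Antitone fun n => (q n).1.2 := antitone_nat_of_succ_le fun n => by
    rw [hq]
    exact hn2 _
  have hle : ∀ n m, (q n).1.1 ≤ (q m).1.2 := fun n m =>
    (hmono (le_max_left n m)).trans ((q _).2.2.1.trans (hanti (le_max_right n m)))
  have hlub : IsLUB (range fun n => (q n).1.1) (sSup (range fun n => (q n).1.1)) :=
    isLUB_csSup (range_nonempty _) ⟨(q 0).1.2, by rintro _ ⟨n, rfl⟩; exact hle n 0⟩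
  have hp2 : ∀ m, sSup (range fun n => (q n).1.1) ≤ (q m).1.2 := fun m =>
    hlub.2 (by rintro _ ⟨n, rfl⟩; exact hle n m)
  refine ⟨_, ⟨hlub.1 ⟨0, rfl⟩, hp2 0⟩, fun n => ⟨(q n).1.1, (q n).1.2, (q n).2.1, hlub.1 ⟨n, rfl⟩,
    hp2 n, (q n).2.2.2, ?_⟩⟩
  induction n with
  | zero => exact ⟨by rw [pow_zero, one_mul]; rfl, by rw [pow_zero, one_mul]; exact le_rfl⟩
  | succ n ih =>
    rw [hq]
    have h3 := hn3 (q n)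
    have h4 := mul_le_mul_of_nonneg_left (hn4 (q n)) (two_pow_nonneg (E := E) n)
    refine ⟨?_, ih.2.trans (h4.trans_eq (by ring))⟩
    rw [← ih.1, ← h3]
    ring

/-- The mean value inequality on an interval in which `H` is differentiable everywhere. -/
theorem sub_le_mul_of_forall_hasDyadicDerivWithinAt {H h : E → E} {s : Set E} {x y M : E}
    (hxy : x ≤ y) (hs : Icc x y ⊆ s) (hH : IdempotentLocalOn H s)
    (hd : ∀ p ∈ Icc x y, HasDyadicDerivWithinAt H s (h p) p)
    (hM : ∀ p ∈ Icc x y, h p * (y - x) ≤ M * (y - x)) : H y - H x ≤ M * (y - x) := by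
  have hH' : IdempotentLocalOn (fun t => H t - M * t) (Icc x y) := fun e he p hp q hq hpq => by
    have := hH e he p (hs hp) q (hs hq) hpq
    linear_combination this - M * hpq
  obtain ⟨p, hp, hb⟩ := exists_nested_increments hxy hH'
  obtain ⟨r, hr, hu, hd⟩ := hd p hp
  have hz : 0 ≤ y - x := sub_nonneg.2 hxy
  obtain ⟨A, hA, hd⟩ := hd _ hz
  have hMp := hM p hp
  set z := y - x with hz_def
  rw [← sub_nonpos]
  refine nonpos_of_forall_le_mul hA hz fun ε hε => ?_
  obtain ⟨N, hN⟩ := hd ε hε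
  have hε0 : 0 ≤ ε := hA.1 hε
  rw [← sub_nonpos, ← posPart_eq_zero]
  set v := (H y - H x - M * z - z * ε)⁺ with hv
  have hv0 : 0 ≤ v := posPart_nonneg _
  refine hu v (le_antisymm ?_ (mul_nonneg hv0 hr))
  refine nonpos_of_two_pow_mul_le (mul_nonneg hv0 hz) N fun k hk => ?_
  obtain ⟨x', y', h1, h2, h3, h4, h5, h6⟩ := hb k
  have h2k := two_pow_nonneg (E := E) k
  -- `e` is the band on which the nested interval lies within the range `r` of differentiability
  obtain ⟨e, he, h7, h8⟩ := exists_idempotent_le z (2 ^ k * r)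
  have he0 := idempotent_nonneg he
  have he1 := idempotent_nonneg (idempotent_compl he)
  have hps : p ∈ s := hs hp
  have near : ∀ t ∈ Icc x y, |t - p| ≤ y' - x' →
      e * |H t - H p - (t - p) * h p| ≤ e * |t - p| * ε := by
    intro t ht htp
    have hw := hs (idempotent_mix_mem_Icc he ht hp)
    have e1 : e * t + (1 - e) * p - p = e * (t - p) := by ring
    have e2 : |e * t + (1 - e) * p - p| = e * |t - p| := by rw [e1, abs_mul_of_nonneg he0]
    have h9 : 2 ^ k * (e * |t - p|) ≤ e * z := by
      linear_combination (2 ^ k * e) * htp + e * h5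
    have h10 : e * |t - p| ≤ r := by
      have : e * |t - p| ≤ e * r := le_of_two_pow_mul_le (n := k) (by linear_combination h9 + h7)
      linear_combination this + (1 - e) * hr
    have h11 : 2 ^ N * (e * |t - p|) ≤ z := by
      refine (two_pow_mul_le_two_pow_mul hk (mul_nonneg he0 (abs_nonneg _))).trans ?_
      linear_combination h9 + (1 - e) * hz
    have := hN _ hw (e2 ▸ h10) (e2 ▸ h11)
    rw [e2, hH.map_mix he (hs ht) hps hw, e1] at this
    rw [← abs_mul_of_nonneg he0]
    convert this using 2
    ring
  have n1 := near x' ⟨h1, h2.trans hp.2⟩ (by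
    rw [abs_sub_comm, abs_of_nonneg (sub_nonneg.2 h2)]
    exact sub_le_sub_right h3 _)
  have n2 := near y' ⟨hp.1.trans h3, h4⟩ (by
    rw [abs_of_nonneg (sub_nonneg.2 h3)]
    exact sub_le_sub_left h2 _)
  rw [abs_sub_comm x' p, abs_of_nonneg (sub_nonneg.2 h2)] at n1
  rw [abs_of_nonneg (sub_nonneg.2 h3)] at n2
  have m1 := mul_le_mul_of_nonneg_left (neg_le_abs (H x' - H p - (x' - p) * h p)) he0
  have m2 := mul_le_mul_of_nonneg_left (le_abs_self (H y' - H p - (y' - p) * h p)) he0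
  have m3 : e * (H y' - H x' - (y' - x') * h p) ≤ e * (y' - x') * ε := by
    linear_combination n1 + n2 + m1 + m2
  have m4 : e * (H y - H x - M * z - z * ε) ≤ 0 := by
    linear_combination e * h6 + 2 ^ k * m3 + e * hMp + (e * (h p - M + ε)) * h5 - (e * M) * hz_def
  have m5 : e * v = 0 := by
    rw [hv, ← posPart_mul_of_nonneg he0]
    exact posPart_of_nonpos m4
  linear_combination v * h8 + (2 ^ k * r - z) * m5

end Dyadic

section Calculus

variable {E : Type u} [CommRing E] [ConditionallyCompleteLattice E] [IsOrderedAddMonoid E]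
  [IsFAlgebra E] [Algebra ℝ E] [IsOrderedModule ℝ E]

omit [IsFAlgebra E] [Algebra ℝ E] [IsOrderedModule ℝ E] [IsOrderedAddMonoid E]
  [ConditionallyCompleteLattice E] in
/-- A weak order unit assembled from one on the support `s` of `z` and one off it. -/
theorem weakUnit_mix {s z l w : E} (hs : s * s = s) (hu : ∀ u, u * z = 0 → u * s = 0)
    (hl : ∀ u, u * l = 0 → u * z = 0) (hsl : s * l = l) (hw : ∀ u, u * w = 0 → u = 0) (u : E)
    (h : u * (l + (1 - s) * w) = 0) : u = 0 := by
  have h1 := hu u (hl u (by linear_combination s * h - u * hsl + u * w * hs))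
  have h2 : u * (1 - s) = 0 := hw _ (by linear_combination h - l * h1 + u * hsl)
  linear_combination h1 + h2

/-- The mean value inequality on subintervals of `[a, b]` when differentiability is known in the
order open interval `(a, b)` only. -/
theorem sub_le_mul_of_openInterval {H h : E → E} {a b x y M : E} (hab : WeakUnitLT a b)
    (hH : IdempotentLocalOn H (Icc a b)) (hh : IdempotentLocalOn h (Icc a b))
    (hc : ∀ c ∈ Icc a b, DyadicContinuousWithinAt H (Icc a b) c)
    (hd : ∀ p ∈ openInterval a b, HasDyadicDerivWithinAt H (Icc a b) (h p) p)
    (hx : x ∈ Icc a b) (hy : y ∈ Icc a b) (hxy : x ≤ y) (hM : ∀ t ∈ Icc x y, h t ≤ M) :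
    H y - H x ≤ M * (y - x) := by
  rw [weakUnitLT_iff] at hab
  have hz : 0 ≤ y - x := sub_nonneg.2 hxy
  obtain ⟨s, hs, hsz, hu⟩ := exists_support hz
  have hs0 := idempotent_nonneg hs
  have hs1 := idempotent_nonneg (idempotent_compl hs)
  have hm2 : 2 * ((1 / 2 : ℝ) • (b - a)) = b - a := by simpa using two_pow_mul_smul 1 (b - a)
  have hm0 : 0 ≤ (1 / 2 : ℝ) • (b - a) := smul_nonneg (by norm_num) (sub_nonneg.2 hab.1)
  set μ := (1 / 2 : ℝ) • (b - a)
  have hμ : ∀ u, u * μ = 0 → u = 0 := fun u h => hab.2 u (by linear_combination 2 * h - u * hm2)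
  have hm : a + μ ∈ Icc a b := ⟨le_add_of_nonneg_right hm0, by linear_combination hm0 + hm2⟩
  -- the inequality for the end points `x + δ` and `y - δ`, with `δ = 2⁻ᵏ (y - x)`
  have key : ∀ δ : E, 0 ≤ δ → δ + δ ≤ y - x → s * δ = δ → (∀ u, u * δ = 0 → u * (y - x) = 0) →
      H (y - δ) - H (x + δ) ≤ M * (y - x - (δ + δ)) := by
    intro δ hδ hδz hsδ hδu
    have hxk : x + δ ∈ Icc a b :=
      ⟨hx.1.trans (le_add_of_nonneg_right hδ), by linear_combination hδz + hδ + hy.2⟩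
    have hyk : y - δ ∈ Icc a b :=
      ⟨by linear_combination hδz + hδ + hx.1, (sub_le_self _ hδ).trans hy.2⟩
    have hxt := idempotent_mix_mem_Icc hs hxk hm
    have hyt := idempotent_mix_mem_Icc hs hyk hm
    have hlen : s * (y - δ) + (1 - s) * (a + μ) - (s * (x + δ) + (1 - s) * (a + μ))
        = y - x - (δ + δ) := by linear_combination hsz - 2 * hsδ
    have hle : s * (x + δ) + (1 - s) * (a + μ) ≤ s * (y - δ) + (1 - s) * (a + μ) :=
      sub_nonneg.1 (by rw [hlen]; exact sub_nonneg.2 hδz)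
    have hκ0 : 0 ≤ δ + (1 - s) * μ := add_nonneg hδ (mul_nonneg hs1 hm0)
    have hκu := weakUnit_mix hs hu hδu hsδ hμ
    have hsub : Icc (s * (x + δ) + (1 - s) * (a + μ)) (s * (y - δ) + (1 - s) * (a + μ))
        ⊆ openInterval a b := by
      intro p hp
      have h1 : δ + (1 - s) * μ ≤ p - a := by linear_combination hp.1 + s * hx.1 - hsδ
      have h2 : δ + (1 - s) * μ ≤ b - p := by
        linear_combination hp.2 + s * hy.2 - hsδ + (1 - s) * hm2
      exact ⟨weakUnitLT_iff.2 ⟨sub_nonneg.1 (hκ0.trans h1), weakUnit_of_le hκ0 hκu h1⟩,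
        weakUnitLT_iff.2 ⟨sub_nonneg.1 (hκ0.trans h2), weakUnit_of_le hκ0 hκu h2⟩⟩
    have hmvt := sub_le_mul_of_forall_hasDyadicDerivWithinAt (H := H) (h := h) (M := M) hle
      (Icc_subset_Icc hxt.1 hyt.2) hH (fun p hp => hd p (hsub hp)) (fun p hp => by
        rw [hlen]
        have hp' : p ∈ Icc a b := ⟨hxt.1.trans hp.1, hp.2.trans hyt.2⟩
        have e1 : s * p ≤ s * y := by
          linear_combination s * hp.2 + hδ + (y - δ - (a + μ)) * hs - hsδ
        have e2 : s * x ≤ s * p := by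
          linear_combination s * hp.1 + hδ + (a + μ - (x + δ)) * hs - hsδ
        have hp1 : s * p + (1 - s) * x ∈ Icc x y :=
          ⟨by linear_combination e2, by linear_combination e1 + (1 - s) * hxy⟩
        have hl0 : 0 ≤ y - x - (δ + δ) := sub_nonneg.2 hδz
        have hloc := hh.mul_eq_mul hp' ⟨hx.1.trans hp1.1, hp1.2.trans hy.2⟩ hl0
          (by linear_combination (-(p - x)) * (hsz - 2 * hsδ))
        rw [hloc]
        exact mul_le_mul_of_nonneg_right (hM _ hp1) hl0)
    rw [hlen, hH.map_mix hs hxk hm hxt, hH.map_mix hs hyk hm hyt] at hmvt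
    have hoff := hH (1 - s) (idempotent_compl hs) _ hyk _ hxk
      (by linear_combination -hsz + 2 * hsδ)
    linear_combination hmvt + hoff
  obtain ⟨A, hA, hA'⟩ := hc x hx _ hz
  obtain ⟨B, hB, hB'⟩ := hc y hy _ hz
  rw [← sub_nonpos]
  refine nonpos_of_forall_le_mul hA zero_le_one fun ε hε => ?_
  rw [← sub_nonpos]
  refine nonpos_of_forall_le_mul hB zero_le_one fun η hη => ?_
  rw [← sub_nonpos]
  obtain ⟨n, hn⟩ := hA' ε hε
  obtain ⟨m, hm⟩ := hB' η hη
  refine nonpos_of_two_pow_mul_le (z := 2 * (|M| * (y - x)))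
    (mul_nonneg zero_le_two (mul_nonneg (abs_nonneg M) hz)) (n + m + 1) fun k hk => ?_
  have hδe := two_pow_mul_smul k (y - x)
  have hδ0 : 0 ≤ ((1 / 2 : ℝ) ^ k) • (y - x) := smul_nonneg (by positivity) hz
  set δ := ((1 / 2 : ℝ) ^ k) • (y - x) with hδ
  have hbd : ∀ j, j ≤ k → 2 ^ j * δ ≤ y - x := fun j hj =>
    (two_pow_mul_le_two_pow_mul hj hδ0).trans_eq hδe
  have h2δ : δ + δ ≤ y - x := by
    have := hbd 1 (by omega)
    rwa [pow_one, two_mul] at this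
  have hsδ : s * δ = δ := by rw [hδ, mul_smul_comm, hsz]
  have h1 := key δ hδ0 h2δ hsδ fun u hu => by linear_combination (2 ^ k) * hu - u * hδe
  have h2 := hn (x + δ) ⟨hx.1.trans (le_add_of_nonneg_right hδ0), by
    linear_combination h2δ + hδ0 + hy.2⟩ (by
      rw [add_sub_cancel_left, abs_of_nonneg hδ0]
      exact hbd n (by omega))
  have h3 := hm (y - δ) ⟨by linear_combination h2δ + hδ0 + hx.1, (sub_le_self _ hδ0).trans hy.2⟩ (by
      rw [abs_sub_comm, sub_sub_cancel, abs_of_nonneg hδ0]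
      exact hbd m (by omega))
  have h4 := (le_abs_self _).trans h2
  have h5 := (neg_le_abs _).trans h3
  have h6 := mul_le_mul_of_nonneg_right (neg_le_abs M) hδ0
  have h2k := two_pow_nonneg (E := E) k
  have h7 : H y - H x - M * (y - x) - 1 * ε - 1 * η ≤ 2 * (|M| * δ) := by
    linear_combination h1 + h4 + h5 + h6 + h6
  linear_combination 2 ^ k * h7 + 2 * |M| * hδe

/-! ### The fundamental theorem and the chain rule -/

theorem sub_le_upperIntegral {H h : E → E} {a b K : E} (hab : WeakUnitLT a b)
    (hH : IdempotentLocalOn H (Icc a b)) (hh : IdempotentLocalOn h (Icc a b))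
    (hc : ∀ c ∈ Icc a b, DyadicContinuousWithinAt H (Icc a b) c)
    (hd : ∀ p ∈ openInterval a b, HasDyadicDerivWithinAt H (Icc a b) (h p) p)
    (hK : ∀ x ∈ Icc a b, |h x| ≤ K) : H b - H a ≤ upperIntegral h a b := by
  have hle := (weakUnitLT_iff.1 hab).1
  refine le_upperIntegral hle fun n x hx => ?_
  rw [← hx.2.1, ← hx.1, ← Finset.sum_range_sub (fun i => H (x i))]
  refine Finset.sum_le_sum fun i hi => ?_
  have hi' := Finset.mem_range.1 hi
  have hxi := hx.mem hi'.le
  have hxj := hx.mem (show i + 1 ≤ n from hi')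
  exact sub_le_mul_of_openInterval hab hH hh hc hd hxi hxj (hx.2.2 i hi') fun t ht =>
    le_csSup ((bddAbove_image_of_abs_le hK).mono (image_mono (Icc_subset_Icc hxi.1 hxj.2)))
      ⟨t, ht, rfl⟩

/-- The fundamental theorem of calculus for an integrable derivative. -/
theorem upperIntegral_eq_sub {H h : E → E} {a b : E} (hab : WeakUnitLT a b)
    (hH : IdempotentLocalOn H (Icc a b)) (hh : IdempotentLocalOn h (Icc a b))
    (hc : ∀ c ∈ Icc a b, DyadicContinuousWithinAt H (Icc a b) c)
    (hd : ∀ p ∈ openInterval a b, HasDyadicDerivWithinAt H (Icc a b) (h p) p)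
    (hi : IntegrableOnIcc h a b) : upperIntegral h a b = H b - H a := by
  obtain ⟨K, hK⟩ := exists_abs_le_of_bdd hi.1 hi.2.1
  have h1 := sub_le_upperIntegral hab hH hh hc hd hK
  have h2 := sub_le_upperIntegral hab hH.neg hh.neg (fun c hc' => (hc c hc').neg)
    (fun p hp => (hd p hp).neg) (abs_neg_le_of_forall_abs_le hK)
  have h3 := (integrableOnIcc_iff (weakUnitLT_iff.1 hab).1 hK).1 hi
  exact le_antisymm (by linear_combination h2 + h3) h1

/-- The chain rule for an indefinite integral: its derivative at `G p` is `f (G p)`, also when `G p`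
lies on the boundary of `[c, d]`. -/
theorem HasDyadicDerivWithinAt.upperIntegral_comp [Nontrivial E] {f G : E → E} {s : Set E}
    {c d g p K : E} (hG : HasDyadicDerivWithinAt G s g p) (hmaps : MapsTo G s (Icc c d))
    (hp : p ∈ s) (hf : IdempotentLocalOn f (Icc c d)) (hK : ∀ x ∈ Icc c d, |f x| ≤ K)
    (hfc : DyadicContinuousWithinAt f (Icc c d) (G p)) :
    HasDyadicDerivWithinAt (fun x => upperIntegral f c (G x)) s (f (G p) * g) p := by
  obtain ⟨r, hr, hu, hd⟩ := hG
  refine ⟨r, hr, hu, fun z hz => ?_⟩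
  obtain ⟨A, hA, hA'⟩ := hd z hz
  obtain ⟨ε₀, hε₀⟩ : A.Nonempty := hA.nonempty
  have hε₀0 : 0 ≤ ε₀ := hA.1 hε₀
  have hL : 0 ≤ |g| + ε₀ := add_nonneg (abs_nonneg g) hε₀0
  obtain ⟨n₀, hn₀⟩ := hA' ε₀ hε₀
  obtain ⟨B, hB, hB'⟩ := hfc (z * (|g| + ε₀)) (mul_nonneg hz hL)
  refine ⟨_, isGLB_mul_add_mul hA hB (abs_nonneg (f (G p))) hL, ?_⟩
  rintro _ ⟨ε, hε, η, hη, rfl⟩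
  obtain ⟨n, hn⟩ := hA' ε hε
  obtain ⟨m, hm⟩ := hB' η hη
  refine ⟨n₀ + n + m, fun x hx hxr hxz => ?_⟩
  have hbd : ∀ j, j ≤ n₀ + n + m → 2 ^ j * |x - p| ≤ z := fun j hj =>
    (two_pow_mul_le_two_pow_mul hj (abs_nonneg _)).trans hxz
  have hη0 : 0 ≤ η := hB.1 hη
  have h0 := hn₀ x hx hxr (hbd n₀ (by omega))
  have h1 := hn x hx hxr (hbd n (by omega))
  have hinc : |G x - G p| ≤ |x - p| * (|g| + ε₀) := by
    have e : G x - G p = (x - p) * g + (G x - G p - (x - p) * g) := by ring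
    rw [e]
    refine (abs_add_le _ _).trans ?_
    linear_combination abs_mul_le (x - p) g + h0
  have h2m := two_pow_nonneg (E := E) m
  have h2 := abs_upperIntegral_sub_le (A := f (G p)) (w := η) hf hK (hmaps hx) (hmaps hp)
    fun v hv hvx => hm v hv (by
      linear_combination 2 ^ m * hvx + 2 ^ m * hinc + (|g| + ε₀) * hbd m (by omega))
  have e : upperIntegral f c (G x) - upperIntegral f c (G p) - (x - p) * (f (G p) * g)
      = (upperIntegral f c (G x) - upperIntegral f c (G p) - (G x - G p) * f (G p))
        + f (G p) * (G x - G p - (x - p) * g) := by ring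
  change |upperIntegral f c (G x) - upperIntegral f c (G p) - (x - p) * (f (G p) * g)| ≤ _
  rw [e]
  refine (abs_add_le _ _).trans ?_
  have h3 := (abs_mul_le (f (G p)) (G x - G p - (x - p) * g)).trans
    (mul_le_mul_of_nonneg_left h1 (abs_nonneg _))
  linear_combination h2 + h3 + η * hinc

theorem DyadicContinuousWithinAt.upperIntegral_comp {f G : E → E} {s : Set E}
    {c d p K : E} (hG : DyadicContinuousWithinAt G s p) (hmaps : MapsTo G s (Icc c d))
    (hp : p ∈ s) (hf : IdempotentLocalOn f (Icc c d)) (hK : ∀ x ∈ Icc c d, |f x| ≤ K) :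
    DyadicContinuousWithinAt (fun x => upperIntegral f c (G x)) s p := by
  have hK0 : 0 ≤ K := (abs_nonneg _).trans (hK _ (hmaps hp))
  intro z hz
  obtain ⟨A, hA, h⟩ := hG z hz
  refine ⟨_, isGLB_mul_add_mul hA hA hK0 le_rfl, ?_⟩
  rintro _ ⟨ε, hε, η, -, rfl⟩
  obtain ⟨n, hn⟩ := h ε hε
  refine ⟨n, fun v hv hvz => ?_⟩
  have h1 := abs_upperIntegral_sub_le_mul hf hK (hmaps hv) (hmaps hp)
  linear_combination h1 + K * hn v hv hvz

omit [ConditionallyCompleteLattice E] [IsOrderedAddMonoid E] [IsFAlgebra E] [Algebra ℝ E]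
  [IsOrderedModule ℝ E] in
theorem IdempotentLocalOn.comp_mul {f g G : E → E} {s t : Set E} (hf : IdempotentLocalOn f t)
    (hg : IdempotentLocalOn g s) (hG : IdempotentLocalOn G s) (hmaps : MapsTo G s t) :
    IdempotentLocalOn (fun x => f (G x) * g x) s := fun e he x hx y hy hxy => by
  have h1 := hf e he _ (hmaps hx) _ (hmaps hy) (hG e he x hx y hy hxy)
  have h2 := hg e he x hx y hy hxy
  linear_combination g x * h1 + f (G y) * h2

/-- Substitution, with the hypotheses in local and dyadic form. -/
theorem integral_comp_mul_eq [Nontrivial E] {f g G : E → E} {a b c d : E} (hab : WeakUnitLT a b)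
    (hf : IdempotentLocalOn f (Icc c d)) (hg : IdempotentLocalOn g (Icc a b))
    (hmaps : MapsTo G (Icc a b) (Icc c d)) (hG : IdempotentLocalOn G (Icc a b))
    (hfc : ∀ q ∈ Icc c d, DyadicContinuousWithinAt f (Icc c d) q)
    (hGc : ∀ p ∈ Icc a b, DyadicContinuousWithinAt G (Icc a b) p)
    (hGd : ∀ p ∈ openInterval a b, HasDyadicDerivWithinAt G (Icc a b) (g p) p)
    (hfi : IntegrableOnIcc f c d) (hi : IntegrableOnIcc (fun x => f (G x) * g x) a b) :
    IntegrableFromTo f (G a) (G b) ∧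
      integral (fun x => f (G x) * g x) a b = integral f (G a) (G b) := by
  have hle := (weakUnitLT_iff.1 hab).1
  obtain ⟨K, hK⟩ := exists_abs_le_of_bdd hfi.1 hfi.2.1
  obtain ⟨L, hL⟩ := exists_abs_le_of_bdd hi.1 hi.2.1
  have hGa := hmaps (left_mem_Icc.2 hle)
  have hGb := hmaps (right_mem_Icc.2 hle)
  have hop : openInterval a b ⊆ Icc a b := fun p hp =>
    ⟨(weakUnitLT_iff.1 hp.1).1, (weakUnitLT_iff.1 hp.2).1⟩
  have hprod := hf.comp_mul hg hG hmaps
  refine ⟨hfi.mono hf (le_inf hGa.1 hGb.1) inf_le_sup (sup_le hGa.2 hGb.2), ?_⟩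
  rw [integral_eq_sub hf hK hGa hGb, integral_eq_sub hprod hL (left_mem_Icc.2 hle)
    (right_mem_Icc.2 hle)]
  have hFG : IdempotentLocalOn (fun x => upperIntegral f c (G x)) (Icc a b) :=
    fun e he x hx y hy hxy => idempotentLocalOn_upperIntegral hf hK e he _ (hmaps hx) _ (hmaps hy)
      (hG e he x hx y hy hxy)
  have hftc := upperIntegral_eq_sub hab hFG hprod
    (fun p hp => (hGc p hp).upperIntegral_comp hmaps hp hf hK)
    (fun p hp => (hGd p hp).upperIntegral_comp hmaps (hop hp) hf hK (hfc _ (hmaps (hop hp)))) hi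
  have h0 := upperIntegral_add le_rfl hle hprod hL
  rw [hftc] at h0 ⊢
  linear_combination -h0

/-! ### Uniformly order continuous functions are integrable -/

omit [IsFAlgebra E] in
theorem exists_abs_le_of_modulus {f : E → E} {a b ε : E} {n : ℕ}
    (h : ∀ x ∈ Icc a b, ∀ y ∈ Icc a b, 2 ^ n * |x - y| ≤ b - a → |f x - f y| ≤ ε) :
    ∃ K, ∀ x ∈ Icc a b, |f x| ≤ K := by
  refine ⟨|f a| + (2 ^ n : ℕ) • ε, fun x hx => ?_⟩
  have hδe := two_pow_mul_smul n (x - a)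
  have hδ0 : 0 ≤ ((1 / 2 : ℝ) ^ n) • (x - a) := smul_nonneg (by positivity) (sub_nonneg.2 hx.1)
  set δ := ((1 / 2 : ℝ) ^ n) • (x - a)
  have hend : a + (2 ^ n : ℕ) • δ = x := by
    rw [nsmul_eq_mul, Nat.cast_pow, Nat.cast_ofNat, hδe, add_sub_cancel]
  have hmem : ∀ i ≤ 2 ^ n, a + i • δ ∈ Icc a b := fun i hi =>
    ⟨le_add_of_nonneg_right (nsmul_nonneg hδ0 i), by
      refine le_trans ?_ hx.2
      rw [← hend]
      exact add_le_add le_rfl (nsmul_le_nsmul_left hδ0 hi)⟩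
  have key : ∀ i ≤ 2 ^ n, |f (a + i • δ)| ≤ |f a| + i • ε := by
    intro i
    induction i with
    | zero => intro _; simp
    | succ i ih =>
      intro hi
      have h1 := h _ (hmem (i + 1) hi) _ (hmem i (by omega)) (by
        rw [succ_nsmul, ← add_assoc, add_sub_cancel_left, abs_of_nonneg hδ0, hδe]
        exact sub_le_sub_right hx.2 a)
      have h2 := abs_add_le (f (a + i • δ)) (f (a + (i + 1) • δ) - f (a + i • δ))
      rw [add_sub_cancel] at h2
      rw [succ_nsmul ε]
      exact h2.trans ((add_le_add (ih (by omega)) h1).trans_eq (add_assoc _ _ _))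
  have := key _ le_rfl
  rwa [hend] at this

theorem integrableOnIcc_of_modulus {f : E → E} {a b K : E} (hab : a ≤ b)
    (hf : IdempotentLocalOn f (Icc a b)) (hK : ∀ x ∈ Icc a b, |f x| ≤ K) {A : Set E}
    (hA : IsGLB A 0) (h : ∀ ε ∈ A, ∃ n : ℕ, ∀ x ∈ Icc a b, ∀ y ∈ Icc a b,
      2 ^ n * |x - y| ≤ b - a → |f x - f y| ≤ ε) : IntegrableOnIcc f a b := by
  have hz := sub_nonneg.2 hab
  rw [integrableOnIcc_iff hab hK]
  refine le_antisymm ?_ (upperIntegral_add_upperIntegral_neg_nonneg hab hf hK)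
  refine nonpos_of_forall_le_mul hA hz fun ε hε => ?_
  obtain ⟨n, hn⟩ := h ε hε
  have hδe := two_pow_mul_smul n (b - a)
  have hδ0 : 0 ≤ ((1 / 2 : ℝ) ^ n) • (b - a) := smul_nonneg (by positivity) hz
  set δ := ((1 / 2 : ℝ) ^ n) • (b - a)
  have hlen : ∀ i : ℕ, a + (i + 1) • δ - (a + i • δ) = δ := fun i => by rw [succ_nsmul]; abel
  have hpart : IsPartition a b (2 ^ n) (fun i => a + i • δ) := by
    refine ⟨by simp, ?_, fun i _ => ?_⟩
    · simp only [nsmul_eq_mul, Nat.cast_pow, Nat.cast_ofNat, hδe, add_sub_cancel]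
    · exact sub_nonneg.1 (by rw [hlen]; exact hδ0)
  refine (add_le_add (upperIntegral_le_upperSum hK hpart)
    (upperIntegral_le_upperSum (abs_neg_le_of_forall_abs_le hK) hpart)).trans ?_
  have hsum : ∑ _i ∈ Finset.range (2 ^ n), ε * δ = (b - a) * ε := by
    rw [Finset.sum_const, Finset.card_range, nsmul_eq_mul, Nat.cast_pow, Nat.cast_ofNat]
    linear_combination ε * hδe
  unfold upperSum
  rw [← Finset.sum_add_distrib, ← hsum]
  refine Finset.sum_le_sum fun i hi => ?_
  have hi' := Finset.mem_range.1 hi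
  rw [hlen, ← add_mul]
  refine mul_le_mul_of_nonneg_right ?_ hδ0
  have hs : Icc (a + i • δ) (a + (i + 1) • δ) ⊆ Icc a b :=
    Icc_subset_Icc (hpart.mem hi'.le).1 (hpart.mem (show i + 1 ≤ 2 ^ n from hi')).2
  have hne : (Icc (a + i • δ) (a + (i + 1) • δ)).Nonempty := nonempty_Icc.2 (hpart.2.2 i hi')
  rw [← le_sub_iff_add_le]
  refine csSup_le (hne.image f) ?_
  rintro _ ⟨p, hp, rfl⟩
  rw [le_sub_comm]
  refine csSup_le (hne.image _) ?_
  rintro _ ⟨q, hq, rfl⟩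
  have hpq : |p - q| ≤ δ := by
    rw [← hlen i]
    exact abs_le'.2 ⟨sub_le_sub hp.2 hq.1, by rw [neg_sub]; exact sub_le_sub hq.2 hp.1⟩
  have h2n := two_pow_nonneg (E := E) n
  have := (le_abs_self _).trans (hn p (hs hp) q (hs hq) (by
    linear_combination 2 ^ n * hpq + hδe))
  linear_combination this

theorem UniformlyOrderContinuousOn.exists_abs_le [Nontrivial E] {f : E → E} {a b : E}
    (hf : UniformlyOrderContinuousOn f (Icc a b)) (hab : a ≤ b) :
    ∃ K, ∀ x ∈ Icc a b, |f x| ≤ K := by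
  obtain ⟨A, hA, h⟩ := hf.exists_modulus ⟨a, left_mem_Icc.2 hab⟩ (sub_nonneg.2 hab)
  obtain ⟨ε, hε⟩ : A.Nonempty := hA.nonempty
  obtain ⟨n, hn⟩ := h ε hε
  exact exists_abs_le_of_modulus hn

theorem UniformlyOrderContinuousOn.integrableOnIcc [Nontrivial E] {f : E → E} {a b : E}
    (hf : UniformlyOrderContinuousOn f (Icc a b)) (hab : a ≤ b)
    (hfl : IdempotentLocalOn f (Icc a b)) : IntegrableOnIcc f a b := by
  obtain ⟨K, hK⟩ := hf.exists_abs_le hab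
  obtain ⟨A, hA, h⟩ := hf.exists_modulus ⟨a, left_mem_Icc.2 hab⟩ (sub_nonneg.2 hab)
  exact integrableOnIcc_of_modulus hab hfl hK hA h

omit [IsOrderedAddMonoid E] [IsFAlgebra E] [Algebra ℝ E] [IsOrderedModule ℝ E] in
theorem UniformlyOrderContinuousOn.orderContinuousOn {f : E → E} {s : Set E}
    (hf : UniformlyOrderContinuousOn f s) : OrderContinuousOn f s := by
  intro c hc ι _ _ _ x hx hxc
  have key : ∀ y : ι → E, ∀ c : E, OrderTendsto y c ↔ OrderTendsto (fun i => y i - c) 0 :=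
    fun y c => by simp only [OrderTendsto, sub_zero]
  rw [key] at hxc ⊢
  exact hf ι x (fun _ => c) hx (fun _ => hc) hxc

theorem UniformlyOrderContinuousOn.comp_mul {f g G : E → E} {s t : Set E} {K L : E}
    (hf : UniformlyOrderContinuousOn f t) (hg : UniformlyOrderContinuousOn g s)
    (hG : UniformlyOrderContinuousOn G s) (hmaps : MapsTo G s t) (hK : ∀ x ∈ t, |f x| ≤ K)
    (hL : ∀ x ∈ s, |g x| ≤ L) : UniformlyOrderContinuousOn (fun x => f (G x) * g x) s := by
  intro ι _ _ _ x y hx hy hxy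
  obtain ⟨A, hA, h1⟩ := hf ι _ _ (fun i => hmaps (hx i)) (fun i => hmaps (hy i))
    (hG ι x y hx hy hxy)
  obtain ⟨B, hB, h2⟩ := hg ι x y hx hy hxy
  have i₀ : ι := Classical.arbitrary ι
  have hK0 : 0 ≤ K := (abs_nonneg _).trans (hK _ (hmaps (hx i₀)))
  have hL0 : 0 ≤ L := (abs_nonneg _).trans (hL _ (hx i₀))
  refine ⟨_, isGLB_mul_add_mul hA hB hL0 hK0, ?_⟩
  rintro _ ⟨ε, hε, η, hη, rfl⟩
  obtain ⟨i₁, h1⟩ := h1 ε hε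
  obtain ⟨i₂, h2⟩ := h2 η hη
  obtain ⟨i₃, h13, h23⟩ := exists_ge_ge i₁ i₂
  refine ⟨i₃, fun i hi => ?_⟩
  have h1 := h1 i (h13.trans hi)
  have h2 := h2 i (h23.trans hi)
  rw [sub_zero] at h1 h2 ⊢
  have e : f (G (x i)) * g (x i) - f (G (y i)) * g (y i)
      = g (x i) * (f (G (x i)) - f (G (y i))) + f (G (y i)) * (g (x i) - g (y i)) := by ring
  change |f (G (x i)) * g (x i) - f (G (y i)) * g (y i)| ≤ _
  rw [e]
  refine (abs_add_le _ _).trans (add_le_add ?_ ?_)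
  · exact (abs_mul_le _ _).trans (mul_le_mul (hL _ (hx i)) h1 (abs_nonneg _) hL0)
  · exact (abs_mul_le _ _).trans (mul_le_mul (hK _ (hmaps (hy i))) h2 (abs_nonneg _) hK0)

/-! ### Super order differentiable functions are local -/

omit [IsFAlgebra E] [IsOrderedModule ℝ E] [IsOrderedAddMonoid E] in
theorem HasSuperOrderDerivAt.hasOrderDerivAt {G : E → E} {s : Set E} {g p : E}
    (h : HasSuperOrderDerivAt s G g p) : HasOrderDerivAt s G g p := by
  obtain ⟨r, hr, hrs, h⟩ := h
  refine ⟨r, hr, hrs, fun D hD => ?_⟩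
  obtain ⟨A, hA, h⟩ := h D hD
  refine ⟨A, hA, fun ε hε => ?_⟩
  obtain ⟨δ, hδ, h⟩ := h ε hε
  exact ⟨δ, hδ, fun x hx => h x (hrs hx)⟩

omit [IsOrderedAddMonoid E] [IsFAlgebra E] in
theorem abs_smul_le_abs_smul_abs (r : ℝ) (v : E) : |r • v| ≤ |r| • |v| := by
  have key : ∀ v : E, r • v ≤ |r| • |v| := fun v => by
    rcases le_total 0 r with hr | hr
    · rw [abs_of_nonneg hr]
      exact smul_le_smul_of_nonneg_left (le_abs_self v) hr
    · rw [abs_of_nonpos hr, ← neg_smul_neg]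
      exact smul_le_smul_of_nonneg_left (neg_le_abs v) (neg_nonneg.2 hr)
  refine abs_le'.2 ⟨key v, ?_⟩
  have := key (-v)
  rwa [smul_neg, abs_neg] at this

/-- If `G` is super order differentiable along the segment from `x` to `y` and `e x = e y`, then
`e G` is locally constant along the segment, hence constant. -/
theorem mul_eq_mul_of_hasSuperOrderDerivAt [Nontrivial E] {G g : E → E} {s : Set E} {e x y : E}
    (he : e * e = e)
    (hseg : ∀ t : ℝ, 0 ≤ t → t ≤ 1 → x + t • (y - x) ∈ s ∧
      HasSuperOrderDerivAt s G (g (x + t • (y - x))) (x + t • (y - x)))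
    (hxy : e * x = e * y) : e * G x = e * G y := by
  have he0 := idempotent_nonneg he
  let φ : Icc (0 : ℝ) 1 → E := fun t => e * G (x + (t : ℝ) • (y - x))
  have hφ : IsLocallyConstant φ := by
    rw [IsLocallyConstant.iff_eventually_eq]
    intro t
    obtain ⟨-, r, -, -, h⟩ := hseg t t.2.1 t.2.2
    obtain ⟨A, hA, h⟩ := h _ (decreasesToZero_dyadic (abs_nonneg (y - x)))
    obtain ⟨ε, hε⟩ : A.Nonempty := hA.nonempty
    obtain ⟨_, ⟨n, rfl⟩, hn⟩ := h ε hε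
    have hpos : (0 : ℝ) < (1 / 2) ^ n := by positivity
    filter_upwards [Metric.ball_mem_nhds t hpos] with t' ht'
    have ht : |(t' : ℝ) - t| ≤ (1 / 2) ^ n := by
      have := Metric.mem_ball.1 ht'
      rw [Subtype.dist_eq, Real.dist_eq] at this
      exact this.le
    have e1 : x + (t' : ℝ) • (y - x) - (x + (t : ℝ) • (y - x)) = ((t' : ℝ) - t) • (y - x) := by
      rw [sub_smul]; abel
    have e2 : e * (((t' : ℝ) - t) • (y - x)) = 0 := by
      rw [mul_smul_comm, mul_sub, hxy, sub_self, smul_zero]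
    have h1 := hn _ (hseg t' t'.2.1 t'.2.2).1 (by
      rw [e1]
      exact (abs_smul_le_abs_smul_abs _ _).trans
        (smul_le_smul_of_nonneg_right ht (abs_nonneg _)))
    rw [e1] at h1
    have h2 := mul_le_mul_of_nonneg_left h1 he0
    rw [← mul_assoc, ← abs_mul_of_nonneg he0, ← abs_mul_of_nonneg he0, e2, abs_zero,
      zero_mul] at h2
    have h3 := eq_zero_of_abs_eq_zero (le_antisymm h2 (abs_nonneg _))
    change e * _ = e * _
    linear_combination h3 + g (x + (t : ℝ) • (y - x)) * e2
  have := hφ.apply_eq_of_preconnectedSpace ⟨0, by simp⟩ ⟨1, by simp⟩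
  simpa [φ] using this

/-- Super order differentiable functions are local: the values of such a function on a band depend
only on the argument there. -/
theorem idempotentLocalOn_of_hasSuperOrderDerivAt [Nontrivial E] {G g : E → E} {a b : E}
    (hab : WeakUnitLT a b) (hc : ∀ c ∈ Icc a b, DyadicContinuousWithinAt G (Icc a b) c)
    (hd : ∀ p ∈ openInterval a b, HasSuperOrderDerivAt (Icc a b) G (g p) p) :
    IdempotentLocalOn G (Icc a b) := by
  rw [weakUnitLT_iff] at hab
  have hz := sub_nonneg.2 hab.1
  -- pulling a point towards the midpoint of `[a, b]` moves it into `(a, b)`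
  let pull : ℕ → E → E := fun k x => x + ((1 / 2 : ℝ) ^ (k + 1)) • (a + b - (x + x))
  have hpull : ∀ k x, 2 ^ (k + 1) * (pull k x - x) = a + b - (x + x) := fun k x => by
    simp only [pull, add_sub_cancel_left, two_pow_mul_smul]
  have hinner : ∀ k, ∀ x ∈ Icc a b, b - a ≤ 2 ^ (k + 1) * (pull k x - a) ∧
      b - a ≤ 2 ^ (k + 1) * (b - pull k x) := fun k x hx => by
    have h1 := hpull k x
    have h2 := two_pow_mul_le_two_pow_mul (Nat.le_add_left 1 k) (sub_nonneg.2 hx.1)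
    have h3 := two_pow_mul_le_two_pow_mul (Nat.le_add_left 1 k) (sub_nonneg.2 hx.2)
    constructor
    · linear_combination h2 - h1
    · linear_combination h3 + h1
  have hop : ∀ k p, b - a ≤ 2 ^ (k + 1) * (p - a) → b - a ≤ 2 ^ (k + 1) * (b - p) →
      p ∈ openInterval a b := fun k p h1 h2 => by
    have aux : ∀ u v : E, b - a ≤ 2 ^ (k + 1) * (v - u) → WeakUnitLT u v := fun u v h =>
      weakUnitLT_iff.2 ⟨sub_nonneg.1 (le_of_two_pow_mul_le (n := k + 1)
        (by rw [mul_zero]; exact hz.trans h)), fun w hw => weakUnit_of_le hz hab.2 h w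
        (by linear_combination 2 ^ (k + 1) * hw)⟩
    exact ⟨aux _ _ h1, aux _ _ h2⟩
  intro e he x hx y hy hxy
  have he0 := idempotent_nonneg he
  have hk : ∀ k, e * G (pull k x) = e * G (pull k y) := fun k => by
    have h2k := two_pow_nonneg (E := E) (k + 1)
    refine mul_eq_mul_of_hasSuperOrderDerivAt (s := Icc a b) (g := g) he
      (fun t ht0 ht1 => ?_) ?_
    · obtain ⟨i1, i2⟩ := hinner k x hx
      obtain ⟨j1, j2⟩ := hinner k y hy
      have hcomb : ∀ u v w : E, w ≤ u → w ≤ v → w ≤ (1 - t) • u + t • v := fun u v w hu hv => by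
        have h1 := smul_le_smul_of_nonneg_left hu (sub_nonneg.2 ht1)
        have h2 := smul_le_smul_of_nonneg_left hv ht0
        have h3 := add_le_add h1 h2
        rwa [← add_smul, sub_add_cancel, one_smul] at h3
      have hp : pull k x + t • (pull k y - pull k x) ∈ openInterval a b := by
        refine hop k _ ((hcomb _ _ _ i1 j1).trans_eq ?_) ((hcomb _ _ _ i2 j2).trans_eq ?_)
        · simp only [← mul_smul_comm, ← mul_add]
          congr 1
          module
        · simp only [← mul_smul_comm, ← mul_add]
          congr 1
          module
      exact ⟨⟨(weakUnitLT_iff.1 hp.1).1, (weakUnitLT_iff.1 hp.2).1⟩, hd _ hp⟩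
    · refine sub_eq_zero.1 (eq_zero_of_two_pow_mul (n := k + 1) ?_)
      linear_combination e * hpull k x - e * hpull k y + (2 ^ (k + 1) - 2) * hxy
  have hmem : ∀ k, ∀ x ∈ Icc a b, pull k x ∈ Icc a b := fun k x hx => by
    have hp := hop k _ (hinner k x hx).1 (hinner k x hx).2
    exact ⟨(weakUnitLT_iff.1 hp.1).1, (weakUnitLT_iff.1 hp.2).1⟩
  have hdist : ∀ k, ∀ x ∈ Icc a b, 2 ^ k * |pull k x - x| ≤ b - a := fun k x hx => by
    refine (two_pow_mul_le_two_pow_mul (Nat.le_succ k) (abs_nonneg _)).trans ?_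
    rw [← abs_mul_of_nonneg (two_pow_nonneg _), hpull]
    refine abs_le'.2 ⟨?_, ?_⟩
    · linear_combination hx.1 + hx.1
    · linear_combination hx.2 + hx.2
  obtain ⟨A, hA, hA'⟩ := hc x hx _ hz
  obtain ⟨B, hB, hB'⟩ := hc y hy _ hz
  have hfin : |e * G x - e * G y| ≤ 0 := by
    refine nonpos_of_forall_le_mul hA zero_le_one fun ε hε => ?_
    rw [← sub_nonpos]
    refine nonpos_of_forall_le_mul hB zero_le_one fun η hη => ?_
    obtain ⟨n, hn⟩ := hA' ε hε
    obtain ⟨m, hm⟩ := hB' η hη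
    have hclose : ∀ j, j ≤ n + m → ∀ x ∈ Icc a b, 2 ^ j * |pull (n + m) x - x| ≤ b - a :=
      fun j hj x hx => (two_pow_mul_le_two_pow_mul hj (abs_nonneg _)).trans (hdist _ x hx)
    have h1 := hn _ (hmem (n + m) x hx) (hclose n (by omega) x hx)
    have h2 := hm _ (hmem (n + m) y hy) (hclose m (by omega) y hy)
    have h3 : e * G x - e * G y = e * (G (pull (n + m) y) - G y)
        - e * (G (pull (n + m) x) - G x) := by linear_combination hk (n + m)
    have h4 : |e * G x - e * G y| ≤ e * |G (pull (n + m) y) - G y|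
        + e * |G (pull (n + m) x) - G x| := by
      rw [h3, sub_eq_add_neg]
      refine (abs_add_le _ _).trans_eq ?_
      rw [abs_neg, abs_mul_of_nonneg he0, abs_mul_of_nonneg he0]
    have he1 := idempotent_nonneg (idempotent_compl he)
    linear_combination h4 + e * h1 + e * h2 + (1 - e) * hA.1 hε + (1 - e) * hB.1 hη
  exact sub_eq_zero.1 (eq_zero_of_abs_eq_zero (le_antisymm hfin (abs_nonneg _)))

/-- Both substitution rules in commutative `Φ`-algebras. -/
theorem substitution [Nontrivial E] {a b c d : E} (hab : WeakUnitLT a b)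
    (hcd : WeakUnitLT c d) {f g G : E → E}
    (hf : LocallyBandPreservingOn f (Icc c d)) (hg : LocallyBandPreservingOn g (Icc a b))
    (hG : MapsTo G (Icc a b) (Icc c d)) :
    (OrderContinuousOn f (Icc c d) → OrderContinuousOn g (Icc a b) → IntegrableOnIcc f c d →
      IntegrableOnIcc g a b → LocallyBandPreservingOn G (Icc a b) →
      OrderContinuousOn G (Icc a b) →
      (∀ x ∈ openInterval a b, HasOrderDerivAt (Icc a b) G (g x) x) →
      IntegrableOnIcc (fun x => f (G x) * g x) a b →
        IntegrableFromTo f (G a) (G b) ∧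
        integral (fun x => f (G x) * g x) a b = integral f (G a) (G b)) ∧
    (UniformlyOrderContinuousOn f (Icc c d) → UniformlyOrderContinuousOn g (Icc a b) →
      UniformlyOrderContinuousOn G (Icc a b) →
      (∀ x ∈ openInterval a b, HasSuperOrderDerivAt (Icc a b) G (g x) x) →
        IntegrableOnIcc (fun x => f (G x) * g x) a b ∧
        IntegrableFromTo f (G a) (G b) ∧
        integral (fun x => f (G x) * g x) a b = integral f (G a) (G b)) := by
  have hf' := hf.idempotentLocalOn
  have hg' := hg.idempotentLocalOn
  refine ⟨fun hfc _ hfi _ hGl hGc hGd hi => integral_comp_mul_eq hab hf' hg' hG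
    hGl.idempotentLocalOn (fun q hq => hfc.dyadicContinuousWithinAt hq)
    (fun p hp => hGc.dyadicContinuousWithinAt hp)
    (fun p hp => (hGd p hp).hasDyadicDerivWithinAt) hfi hi, fun hfu hgu hGu hGd => ?_⟩
  have hab' := (weakUnitLT_iff.1 hab).1
  have hcd' := (weakUnitLT_iff.1 hcd).1
  have hGc : ∀ p ∈ Icc a b, DyadicContinuousWithinAt G (Icc a b) p := fun p hp =>
    hGu.orderContinuousOn.dyadicContinuousWithinAt hp
  have hGl := idempotentLocalOn_of_hasSuperOrderDerivAt hab hGc hGd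
  obtain ⟨K, hK⟩ := hfu.exists_abs_le hcd'
  obtain ⟨L, hL⟩ := hgu.exists_abs_le hab'
  have hi : IntegrableOnIcc (fun x => f (G x) * g x) a b :=
    (hfu.comp_mul hgu hGu hG hK hL).integrableOnIcc hab' (hf'.comp_mul hg' hGl hG)
  exact ⟨hi, integral_comp_mul_eq hab hf' hg' hG hGl
    (fun q hq => hfu.orderContinuousOn.dyadicContinuousWithinAt hq) hGc
    (fun p hp => (hGd p hp).hasOrderDerivAt.hasDyadicDerivWithinAt)
    (hfu.integrableOnIcc hcd' hf') hi⟩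

end Calculus
end RieszIntegral

theorem propositionp {E : Type*} [Ring E] [ConditionallyCompleteLattice E] [IsOrderedAddMonoid E]
    [Algebra ℝ E] [IsOrderedModule ℝ E] [RieszIntegral.IsFAlgebra E]
    {a b c d : E} (hab : RieszIntegral.WeakUnitLT a b) (hcd : RieszIntegral.WeakUnitLT c d)
    {f g G : E → E}
    (hf : RieszIntegral.LocallyBandPreservingOn f (Set.Icc c d))
    (hg : RieszIntegral.LocallyBandPreservingOn g (Set.Icc a b))
    (hG : Set.MapsTo G (Set.Icc a b) (Set.Icc c d)) :
    (RieszIntegral.OrderContinuousOn f (Set.Icc c d) →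
      RieszIntegral.OrderContinuousOn g (Set.Icc a b) →
      RieszIntegral.IntegrableOnIcc f c d →
      RieszIntegral.IntegrableOnIcc g a b →
      RieszIntegral.LocallyBandPreservingOn G (Set.Icc a b) →
      RieszIntegral.OrderContinuousOn G (Set.Icc a b) →
      (∀ x ∈ RieszIntegral.openInterval a b,
        RieszIntegral.HasOrderDerivAt (Set.Icc a b) G (g x) x) →
      RieszIntegral.IntegrableOnIcc (fun x => f (G x) * g x) a b →
        RieszIntegral.IntegrableFromTo f (G a) (G b) ∧
        RieszIntegral.integral (fun x => f (G x) * g x) a b =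
          RieszIntegral.integral f (G a) (G b)) ∧
    (RieszIntegral.UniformlyOrderContinuousOn f (Set.Icc c d) →
      RieszIntegral.UniformlyOrderContinuousOn g (Set.Icc a b) →
      RieszIntegral.UniformlyOrderContinuousOn G (Set.Icc a b) →
      (∀ x ∈ RieszIntegral.openInterval a b,
        RieszIntegral.HasSuperOrderDerivAt (Set.Icc a b) G (g x) x) →
        RieszIntegral.IntegrableOnIcc (fun x => f (G x) * g x) a b ∧
        RieszIntegral.IntegrableFromTo f (G a) (G b) ∧
        RieszIntegral.integral (fun x => f (G x) * g x) a b =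
          RieszIntegral.integral f (G a) (G b)) := by
  rcases subsingleton_or_nontrivial E with hE | hE
  · have hi : ∀ (h : E → E) (u v : E), RieszIntegral.IntegrableOnIcc h u v := fun h u v =>
      ⟨⟨0, fun _ _ => (Subsingleton.elim _ _).le⟩, ⟨0, fun _ _ => (Subsingleton.elim _ _).le⟩,
        Subsingleton.elim _ _⟩
    exact ⟨fun _ _ _ _ _ _ _ _ => ⟨hi _ _ _, Subsingleton.elim _ _⟩,
      fun _ _ _ _ => ⟨hi _ _ _, hi _ _ _, Subsingleton.elim _ _⟩⟩
  · let _ : CommRing E :=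
      { (inferInstance : Ring E) with mul_comm := RieszIntegral.mul_comm_of_isFAlgebra }
    exact RieszIntegral.substitution hab hcd hf hg hG
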